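/- **Setting.** Consider the plant $\dot x = Ax+Bu+B_ww$, $z = Cx+Du+D_ww$ with $x\in\mathbb R^n$, $u\in\mathbb R^m$, $z\in\mathbb R^r$, $A$ Hurwitz, and a constant exogenous signal $w\in\mathcal W\subset\mathbb R^{n_w}$, where $\mathcal W$ is convex and compact. Put $G_u=-CA^{-1}B+D$ and $G_w=-CA^{-1}B_w+D_w$. For $w\in\mathcal W$ consider the steady-state problem $$\min_{\bar u\in\mathcal U,\ \bar z\in\mathcal Z}\ f_0(\bar u)+g_0(\bar z)\quad\text{s.t.}\quad \bar z=G_u\bar u+G_ww,\qquad 0=H_z\bar z+H_u\bar u+H_ww, \tag{1}$$ with $H_w\in\mathbb R^{n_c\times n_w}$, $\mathcal U\subseteq\mathbb R^m$ and $\mathcal Z\subseteq\mathbb R^r$ convex, $f_0:\mathcal U\to\mathbb R$ and $g_0:\mathcal Z\to\mathbb R$ convex, and continuously differentiable with locally Lipschitz gradients on $\operatorname{int}\mathcal U$ and $\operatorname{int}\mathcal Z$ respectively. Assume that for every $w\in\mathcal W$ problem (1) has an optimal solution $(\bar u,\bar z)$ with $\bar u\in\operatorname{int}\mathcal U$ and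 $\bar z\in\operatorname{int}\mathcal Z$ (in particular (1) is strictly feasible). The plant output $z(t)$ and the constraint violation $H_zz(t)+H_uu(t)+H_ww$ are available to the controller. A controller *solves the optimal steady-state (OSS) problem* if for every $w\in\mathcal W$ the closed-loop system has exactly one equilibrium, this equilibrium is locally exponentially stable, and the values $(\bar u,\bar z)$ of input and output at the equilibrium are an optimal solution of (1). For $\tau_p,\tau_d>0$ the *primal-dual controller* is $$\tau_p\dot u=-\nabla f_0(u)-G_u^{\mathsf T}\nabla g_0(z)-(H_zG_u+H_u)^{\mathsf T}\mu,\qquad \tau_d\dot\mu=H_zz+H_uu+H_ww,$$ with $\mu\in\mathbb R^{n_c}$; the closed loop is considered on the set of states with $u\in\operatorname{int}\mathcal U$, $z\in\operatorname{int}\mathcal Z$. **Proposition (Primal-Dual).** Assume that, for some $\kappa>0$ and for every $w\in\mathcal W$, the function $u\mapsto f_0(u)+g_0(G_uu+G_ww)$ is strongly convex with modulus $\kappa$ on $\{u\in\mathcal U: G_uu+G_ww\in\mathcal Z\}$, and that $H_zG_u+H_u$ has full row rank. Then there exists $\tau^\star>0$ such that for all $\tau_p>\tau^\star$ and all $\tau_d>\tau^\star$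 the primal-dual controller solves the OSS problem. -/

import Mathlib

namespace OSS

/-- Euclidean space `ℝᵏ`. -/
abbrev Vec (k : ℕ) : Type := EuclideanSpace ℝ (Fin k)

/-- The action `v ↦ M v` of a real matrix on column vectors. -/
noncomputable def act {k l : ℕ} (M : Matrix (Fin k) (Fin l) ℝ) (v : Vec l) : Vec k :=
  Matrix.toEuclideanLin M v

/-- A real square matrix is Hurwitz if all its complex eigenvalues lie in the open left
half-plane. -/
def IsHurwitz {n : ℕ} (A : Matrix (Fin n) (Fin n) ℝ) : Prop :=
  ∀ s ∈ spectrum ℂ (A.map Complex.ofReal), s.re < 0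

/-- `ζ` is a solution on the time set `I` of the autonomous equation `ζ' = F ζ` posed on the
domain `D`. -/
def IsSolutionOn {X : Type*} [NormedAddCommGroup X] [NormedSpace ℝ X]
    (F : X → X) (D : Set X) (ζ : ℝ → X) (I : Set ℝ) : Prop :=
  (∀ t ∈ I, ζ t ∈ D) ∧ IsIntegralCurveOn ζ (fun _ => F) I

/-- `p` is an equilibrium of `ζ' = F ζ` on `D`. -/
def IsEquilibrium {X : Type*} [NormedAddCommGroup X] [NormedSpace ℝ X]
    (F : X → X) (D : Set X) (p : X) : Prop :=
  p ∈ D ∧ F p = 0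

/-- `p` is a locally exponentially stable equilibrium of `ζ' = F ζ` on `D`: from every initial
state near `p` there is a solution for all forward times, and every forward solution from there,
on whatever time interval, converges to `p` at a uniform exponential rate. -/
def IsLocallyExpStable {X : Type*} [NormedAddCommGroup X] [NormedSpace ℝ X]
    (F : X → X) (D : Set X) (p : X) : Prop :=
  IsEquilibrium F D p ∧
    ∃ δ > 0, ∃ c > 0, ∃ rate > 0, ∀ ζ₀ : X, ‖ζ₀ - p‖ < δ →
      (∃ ζ : ℝ → X, ζ 0 = ζ₀ ∧ IsSolutionOn F D ζ (Set.Ici 0)) ∧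
      ∀ (T : ℝ) (ζ : ℝ → X), ζ 0 = ζ₀ → IsSolutionOn F D ζ (Set.Ico 0 T) →
        ∀ t ∈ Set.Ico 0 T, ‖ζ t - p‖ ≤ c * Real.exp (-rate * t) * ‖ζ₀ - p‖

/-- The data of an optimal steady-state control problem: the plant
`x' = A x + B u + B_w w`, `z = C x + D u + D_w w`, the set `W` of disturbances, the objective
`f₀(u) + g₀(z)` with domains `U` and `Z`, and the engineering constraint
`0 = H_z z + H_u u + H_w w`. Only the values of `f₀` on `U` and of `g₀` on `Z` matter. -/
structure Problem (n m r nw nc : ℕ) where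
  A : Matrix (Fin n) (Fin n) ℝ
  B : Matrix (Fin n) (Fin m) ℝ
  Bw : Matrix (Fin n) (Fin nw) ℝ
  C : Matrix (Fin r) (Fin n) ℝ
  D : Matrix (Fin r) (Fin m) ℝ
  Dw : Matrix (Fin r) (Fin nw) ℝ
  Hz : Matrix (Fin nc) (Fin r) ℝ
  Hu : Matrix (Fin nc) (Fin m) ℝ
  Hw : Matrix (Fin nc) (Fin nw) ℝ
  W : Set (Vec nw)
  U : Set (Vec m)
  Z : Set (Vec r)
  f₀ : Vec m → ℝ
  g₀ : Vec r → ℝ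

namespace Problem

variable {n m r nw nc : ℕ}

/-- The DC gain from `u` to `z`. -/
noncomputable def Gu (P : Problem n m r nw nc) : Matrix (Fin r) (Fin m) ℝ :=
  -P.C * P.A⁻¹ * P.B + P.D

/-- The DC gain from `w` to `z`. -/
noncomputable def Gw (P : Problem n m r nw nc) : Matrix (Fin r) (Fin nw) ℝ :=
  -P.C * P.A⁻¹ * P.Bw + P.Dw

/-- The right-hand side of the state equation. -/
noncomputable def stateField (P : Problem n m r nw nc) (w : Vec nw) (x : Vec n) (u : Vec m) :
    Vec n :=
  act P.A x + act P.B u + act P.Bw w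

/-- The plant output `z = C x + D u + D_w w`. -/
noncomputable def plantOutput (P : Problem n m r nw nc) (w : Vec nw) (x : Vec n) (u : Vec m) :
    Vec r :=
  act P.C x + act P.D u + act P.Dw w

/-- The steady-state output `G_u u + G_w w`. -/
noncomputable def steadyOutput (P : Problem n m r nw nc) (w : Vec nw) (u : Vec m) : Vec r :=
  act P.Gu u + act P.Gw w

/-- The violation `H_z z + H_u u + H_w w` of the engineering constraint. -/
noncomputable def violation (P : Problem n m r nw nc) (w : Vec nw) (u : Vec m) (z : Vec r) :
    Vec nc :=
  act P.Hz z + act P.Hu u + act P.Hw w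

/-- Feasible points of the steady-state optimization problem. -/
def IsFeasible (P : Problem n m r nw nc) (w : Vec nw) (u : Vec m) (z : Vec r) : Prop :=
  u ∈ P.U ∧ z ∈ P.Z ∧ z = P.steadyOutput w u ∧ P.violation w u z = 0

/-- Optimal points of the steady-state optimization problem. -/
def IsOptimal (P : Problem n m r nw nc) (w : Vec nw) (u : Vec m) (z : Vec r) : Prop :=
  P.IsFeasible w u z ∧
    ∀ u' z', P.IsFeasible w u' z' → P.f₀ u + P.g₀ z ≤ P.f₀ u' + P.g₀ z'

/-- The standing assumptions. The interior optimal point in `optimal` makes the problem strictly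
feasible. -/
structure Standing (P : Problem n m r nw nc) : Prop where
  hurwitz : IsHurwitz P.A
  compact_W : IsCompact P.W
  convex_W : Convex ℝ P.W
  convex_f₀ : ConvexOn ℝ P.U P.f₀
  convex_g₀ : ConvexOn ℝ P.Z P.g₀
  contDiff_f₀ : ContDiffOn ℝ 1 P.f₀ (interior P.U)
  contDiff_g₀ : ContDiffOn ℝ 1 P.g₀ (interior P.Z)
  locLip_f₀ : LocallyLipschitzOn (interior P.U) (gradient P.f₀)
  locLip_g₀ : LocallyLipschitzOn (interior P.Z) (gradient P.g₀)
  optimal : ∀ w ∈ P.W, ∃ u ∈ interior P.U, ∃ z ∈ interior P.Z, P.IsOptimal w u z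

end Problem

/-- A dynamic output-feedback controller with state space `X`, `u = output ξ`,
`ξ' = field ξ z ε`, whose inputs are the measurements `z` (plant output) and `ε` (violation of the
engineering constraint); `field` is meaningful for `(ξ, z) ∈ dom`. The disturbance is not
available to it. -/
structure Controller (m r nc : ℕ) (X : Type*) where
  dom : Set (X × Vec r)
  field : X → Vec r → Vec nc → X
  output : X → Vec m

namespace Controller

variable {n m r nw nc : ℕ} {X : Type*}

/-- The plant output in the closed-loop state `(x, ξ)`. -/
noncomputable def loopOutput (K : Controller m r nc X) (P : Problem n m r nw nc) (w : Vec nw)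
    (s : Vec n × X) : Vec r :=
  P.plantOutput w s.1 (K.output s.2)

/-- The states `(x, ξ)` in which the closed loop is defined. -/
def loopDomain (K : Controller m r nc X) (P : Problem n m r nw nc) (w : Vec nw) :
    Set (Vec n × X) :=
  {s | (s.2, K.loopOutput P w s) ∈ K.dom}

/-- The closed-loop vector field. -/
noncomputable def loopField (K : Controller m r nc X) (P : Problem n m r nw nc) (w : Vec nw)
    (s : Vec n × X) : Vec n × X :=
  (P.stateField w s.1 (K.output s.2),
    K.field s.2 (K.loopOutput P w s) (P.violation w (K.output s.2) (K.loopOutput P w s)))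

/-- The controller solves the optimal steady-state control problem: for every `w ∈ W` the closed
loop has exactly one equilibrium, this equilibrium is locally exponentially stable, and the input
and output in equilibrium are optimal. -/
def SolvesOSS [NormedAddCommGroup X] [NormedSpace ℝ X]
    (K : Controller m r nc X) (P : Problem n m r nw nc) : Prop :=
  ∀ w ∈ P.W, ∃ p : Vec n × X,
    IsLocallyExpStable (K.loopField P w) (K.loopDomain P w) p ∧
    (∀ q, IsEquilibrium (K.loopField P w) (K.loopDomain P w) q → q = p) ∧
    P.IsOptimal w (K.output p.2) (K.loopOutput P w p)

end Controller

/-- The primal-dual controller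
`τ_p u' = -∇f₀(u) - G_uᵀ ∇g₀(z) - (H_z G_u + H_u)ᵀ μ`, `τ_d μ' = H_z z + H_u u + H_w w`,
with state `(u, μ)`, defined where the two gradients are. -/
noncomputable def primalDual {n m r nw nc : ℕ} (P : Problem n m r nw nc) (τp τd : ℝ) :
    Controller m r nc (Vec m × Vec nc) where
  dom := {q | q.1.1 ∈ interior P.U ∧ q.2 ∈ interior P.Z}
  field := fun ξ z ε =>
    (τp⁻¹ • (-gradient P.f₀ ξ.1 - act P.Gu.transpose (gradient P.g₀ z)
        - act (P.Hz * P.Gu + P.Hu).transpose ξ.2),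
      τd⁻¹ • ε)
  output := fun ξ => ξ.1

end OSS

/-! The distance `y` of the plant state from its quasi-steady state for the current input satisfies
`y' = A y + Q u'` with `Q = A⁻¹ B`, and the measured output is the steady output plus `C y`. At `y =
0` the controller is therefore the primal-dual gradient flow of the reduced problem in `u` alone,
with strongly convex cost and affine constraint map `M = H_z G_u + H_u`. Off `y = 0` it is perturbed
by terms that are Lipschitz in `y`.

Let `P` be a Lyapunov matrix of `A`. In deviations from equilibrium the function `τp⟨P y, y⟩ + τp/2
‖u‖² + τd/2 ‖μ‖² + ε⟨M u, μ⟩` decreases. The first term yields damping `-2 τp k ‖y‖²`, while the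
drift `Q u'`, weighted by `τp`, costs an amount bounded independently of the time constants. In the
next two terms the saddle coupling cancels, and strong convexity leaves `-κ‖u‖²`. The cross term
supplies the missing decay in `μ`, because full row rank bounds `Mᵀ` below. Choosing `ε = c min(τp,
τd)` keeps the function positive definite and requires no relation between the two time constants
(`decrease_scalar`, `exists_loop_lyapunov`).

Equilibria are exactly the KKT points. One exists because an interior optimum under affine
constraints has a multiplier (`exists_multiplier`); strong monotonicity makes its input unique, and
injectivity of `Mᵀ` its multiplier (`kkt_unique`).

The threshold must not depend on `w`. The only constant that could is the Lipschitz constant of the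
gradients. Strong convexity makes the optimal input continuous in `w` (`continuousOn_optimal`), so
compactness of `W` gives one constant for all `w`; the size of the neighbourhood may still vary with
`w`. -/

namespace OSS
open Set Filter Topology Metric
open scoped NNReal

/-! ### Lyapunov's direct method and forward existence -/

section Flow

variable {X : Type*} [NormedAddCommGroup X] [NormedSpace ℝ X]

/-- A vector field that is Lipschitz near `p` coincides near `p` with a bounded Lipschitz field. -/
lemma exists_bounded_lipschitz_of_lipschitzOn_ball {F : X → X} {p : X} {r : ℝ} (hr : 0 < r)
    {K : ℝ≥0} (hF : LipschitzOnWith K F (ball p (2 * r))) :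
    ∃ (G : X → X) (L K' : ℝ≥0), (∀ s ∈ ball p r, G s = F s) ∧ (∀ s, ‖G s‖ ≤ L) ∧
      LipschitzWith K' G := by
  -- Radial cutoff, equal to 1 on the `r`-ball, 0 outside the `2r`-ball and `1/r`-Lipschitz; the new
  -- field is `φ • F`.
  set φ : X → ℝ := fun s => max 0 (min 1 (2 - ‖s - p‖ / r)) with hφ
  have h0 : ∀ s, 0 ≤ φ s := fun s => le_max_left _ _
  have h1 : ∀ s, φ s ≤ 1 := fun s => max_le zero_le_one (min_le_left _ _)
  have hout : ∀ s, s ∉ ball p (2 * r) → φ s = 0 := by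
    intro s hs
    have h2 : 2 * r ≤ ‖s - p‖ := by simpa [dist_eq_norm] using hs
    have h3 : 2 ≤ ‖s - p‖ / r := by rwa [le_div_iff₀ hr]
    exact max_eq_left ((min_le_right _ _).trans (by linarith))
  have hin : ∀ s ∈ ball p r, φ s = 1 := by
    intro s hs
    have h2 : ‖s - p‖ < r := by simpa [dist_eq_norm] using hs
    have h3 : ‖s - p‖ / r ≤ 1 := by rw [div_le_one hr]; exact h2.le
    simp only [hφ]
    rw [min_eq_left (by linarith), max_eq_right zero_le_one]
  have hlip : ∀ s t, |φ s - φ t| ≤ ‖s - t‖ / r := by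
    intro s t
    refine (abs_max_sub_max_le_max _ _ _ _).trans ?_
    rw [sub_self, abs_zero, max_eq_right (abs_nonneg _)]
    refine (abs_min_sub_min_le_max _ _ _ _).trans ?_
    rw [sub_self, abs_zero, max_eq_right (abs_nonneg _)]
    have : (2 - ‖s - p‖ / r) - (2 - ‖t - p‖ / r) = (‖t - p‖ - ‖s - p‖) / r := by ring
    rw [this, abs_div, abs_of_pos hr]
    gcongr
    refine (abs_norm_sub_norm_le _ _).trans ?_
    rw [sub_sub_sub_cancel_right, norm_sub_rev]
  have hp : p ∈ ball p (2 * r) := mem_ball_self (by linarith)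
  set B : ℝ := ‖F p‖ + K * (2 * r) with hB
  have hB0 : 0 ≤ B := by positivity
  have hbd : ∀ s ∈ ball p (2 * r), ‖F s‖ ≤ B := by
    intro s hs
    have h2 := hF.norm_sub_le hs hp
    have h3 : ‖s - p‖ ≤ 2 * r := by simpa [dist_eq_norm] using (mem_ball.1 hs).le
    calc ‖F s‖ = ‖F p + (F s - F p)‖ := by rw [add_sub_cancel]
      _ ≤ ‖F p‖ + ‖F s - F p‖ := norm_add_le _ _
      _ ≤ B := by
        rw [hB]; gcongr
        exact h2.trans (by gcongr)
  -- Nothing is known about `F` outside the large ball, so the difference is split to involve `F`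
  -- only at points inside it.
  have key : ∀ s t, s ∈ ball p (2 * r) →
      ‖φ s • F s - φ t • F t‖ ≤ (K + B / r) * ‖s - t‖ := by
    intro s t hs
    by_cases ht : t ∈ ball p (2 * r)
    · have e : φ s • F s - φ t • F t = (φ s - φ t) • F s + φ t • (F s - F t) := by module
      rw [e]
      calc _ ≤ ‖(φ s - φ t) • F s‖ + ‖φ t • (F s - F t)‖ := norm_add_le _ _
        _ ≤ (‖s - t‖ / r) * B + 1 * (K * ‖s - t‖) := by
          rw [norm_smul, norm_smul, Real.norm_eq_abs, Real.norm_eq_abs, abs_of_nonneg (h0 t)]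
          have := hlip s t
          have := hbd s hs
          have := hF.norm_sub_le hs ht
          have := h1 t
          gcongr
        _ = _ := by ring
    · have e : φ s • F s - φ t • F t = (φ s - φ t) • F s := by simp [hout t ht]
      rw [e, norm_smul, Real.norm_eq_abs]
      calc _ ≤ (‖s - t‖ / r) * B := by
            have := hlip s t
            have := hbd s hs
            gcongr
        _ ≤ _ := by
            have : 0 ≤ (K : ℝ) * ‖s - t‖ := by positivity
            have e2 : (K + B / r) * ‖s - t‖ = K * ‖s - t‖ + (‖s - t‖ / r) * B := by ring
            linarith
  refine ⟨fun s => φ s • F s, B.toNNReal, (K + B / r).toNNReal, ?_, ?_, ?_⟩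
  · intro s hs
    simp [hin s hs]
  · intro s
    rw [Real.coe_toNNReal _ hB0]
    by_cases hs : s ∈ ball p (2 * r)
    · rw [norm_smul, Real.norm_eq_abs, abs_of_nonneg (h0 s)]
      calc φ s * ‖F s‖ ≤ 1 * B := by
            have := h1 s
            have := hbd s hs
            gcongr
        _ = B := one_mul _
    · simp [hout s hs, hB0]
  · refine LipschitzWith.of_dist_le_mul fun s t => ?_
    rw [Real.coe_toNNReal _ (by positivity), dist_eq_norm, dist_eq_norm]
    by_cases hs : s ∈ ball p (2 * r)
    · exact key s t hs
    · by_cases ht : t ∈ ball p (2 * r)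
      · rw [norm_sub_rev, norm_sub_rev s t]
        exact key t s ht
      · simp only [hout s hs, hout t ht, zero_smul, sub_self, norm_zero]
        positivity

/-- A bounded Lipschitz field has solutions for all forward times. -/
lemma exists_isIntegralCurveOn_Ici [CompleteSpace X] {G : X → X} {L K : ℝ≥0}
    (hL : ∀ s, ‖G s‖ ≤ L) (hK : LipschitzWith K G) (s₀ : X) :
    ∃ ζ : ℝ → X, ζ 0 = s₀ ∧ IsIntegralCurveOn ζ (fun _ => G) (Ici 0) := by
  have hex : ∀ N : ℕ, ∃ α : ℝ → X, α 0 = s₀ ∧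
      ∀ t ∈ Icc (0 : ℝ) N, HasDerivWithinAt α (G (α t)) (Icc (0 : ℝ) N) t := by
    intro N
    -- A field bounded by `L` moves a point by at most `L * N` in time `N`, so this radius lets one
    -- Picard-Lindelöf step cover all of `[0, N]`.
    have h : IsPicardLindelof (fun _ : ℝ => G) (tmin := 0) (tmax := N)
        ⟨0, left_mem_Icc.2 (Nat.cast_nonneg N)⟩ s₀ (L * N) 0 L K :=
      IsPicardLindelof.of_time_independent (fun x _ => hL x) hK.lipschitzOnWith (by simp)
    exact h.exists_eq_forall_mem_Icc_hasDerivWithinAt₀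
  choose α hα0 hα using hex
  have hright : ∀ (N : ℕ), ∀ t ∈ Ico (0 : ℝ) N, HasDerivWithinAt (α N) (G (α N t)) (Ici t) t := by
    intro N t ht
    refine (hα N t (Ico_subset_Icc_self ht)).mono_of_mem_nhdsWithin ?_
    exact mem_of_superset (Icc_mem_nhdsGE ht.2) (Icc_subset_Icc_left ht.1)
  have hcont : ∀ N, ContinuousOn (α N) (Icc (0 : ℝ) N) := fun N t ht =>
    (hα N t ht).continuousWithinAt
  have heq : ∀ N N' : ℕ, N ≤ N' → EqOn (α N) (α N') (Icc (0 : ℝ) N) := by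
    intro N N' h
    have h' : (N : ℝ) ≤ N' := by exact_mod_cast h
    refine ODE_solution_unique (v := fun _ => G) (fun _ => hK) (hcont N) (hright N)
      ((hcont N').mono (Icc_subset_Icc_right h')) (fun t ht => hright N' t ⟨ht.1, ht.2.trans_le h'⟩)
      (by rw [hα0, hα0])
  -- The `+ 1` makes the chosen interval extend strictly beyond `t`, even at integers, so the glued
  -- curve has the right derivative within `Ici 0`.
  refine ⟨fun t => α (⌈t⌉₊ + 1) t, by simp [hα0], fun t ht => ?_⟩
  have ht0 : (0 : ℝ) ≤ t := ht
  set N := ⌈t⌉₊ + 1 with hN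
  have htN : t < N := by
    have := Nat.le_ceil t
    rw [hN]; push_cast; linarith
  have hev : ∀ s ∈ Icc (0 : ℝ) N, α (⌈s⌉₊ + 1) s = α N s := by
    intro s hs
    rcases le_total (⌈s⌉₊ + 1) N with h | h
    · refine heq _ _ h ⟨hs.1, ?_⟩
      have := Nat.le_ceil s
      push_cast; linarith
    · exact (heq _ _ h hs).symm
  have hd := (hα N t ⟨ht0, htN.le⟩).congr hev (hev t ⟨ht0, htN.le⟩)
  refine hd.mono_of_mem_nhdsWithin ?_
  have : Iio (N : ℝ) ∈ 𝓝[Ici 0] t := mem_nhdsWithin_of_mem_nhds (Iio_mem_nhds htN)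
  filter_upwards [this, self_mem_nhdsWithin] with s hs hs0
  exact ⟨hs0, le_of_lt hs⟩

/-- Lyapunov estimate along a curve which satisfies the decay condition as long as it stays in a
ball: it never leaves the ball. -/
lemma lyapunov_decay {V : X → ℝ} {V' : X → X →L[ℝ] ℝ} (hV : ∀ s, HasFDerivAt V (V' s) s)
    {F : X → X} {p : X} {r c rate : ℝ} (hr : 0 < r) (hc : 0 < c) (hrate : 0 < rate)
    (hlow : ∀ s, c * ‖s - p‖ ^ 2 ≤ V s)
    (hdec : ∀ s ∈ ball p r, V' s (F s) ≤ -rate * V s)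
    {ζ : ℝ → X} {T : ℝ} (hcont : ContinuousOn ζ (Icc 0 T))
    (hζ : ∀ t ∈ Ico 0 T, HasDerivWithinAt ζ (F (ζ t)) (Ici t) t)
    (h0 : V (ζ 0) < c * r ^ 2) :
    ∀ t ∈ Icc 0 T, V (ζ t) ≤ V (ζ 0) * Real.exp (-(rate / 2) * t) := by
  intro t ht
  have hVnn : ∀ s, 0 ≤ V s := fun s => le_trans (by positivity) (hlow s)
  -- The comparison principle needs a strict inequality of derivatives at contact. The slack `η`
  -- makes `V` positive there, and the halved rate then gives strictness; contact also forces `V < c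
  -- * r ^ 2`, hence membership in the ball.
  have main : ∀ η, 0 < η → V (ζ 0) + η < c * r ^ 2 →
      V (ζ t) ≤ (V (ζ 0) + η) * Real.exp (-(rate / 2) * t) := by
    intro η hη hη'
    have hVc : Continuous V := continuous_iff_continuousAt.2 fun s => (hV s).continuousAt
    refine image_le_of_deriv_right_lt_deriv_boundary' (f := fun t => V (ζ t))
      (f' := fun t => V' (ζ t) (F (ζ t)))
      (B := fun t => (V (ζ 0) + η) * Real.exp (-(rate / 2) * t))
      (B' := fun t => (V (ζ 0) + η) * (Real.exp (-(rate / 2) * t) * -(rate / 2)))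
      (hVc.comp_continuousOn hcont) (fun x hx => (hV (ζ x)).comp_hasDerivWithinAt x (hζ x hx))
      (by simp; exact hη.le) (by fun_prop) ?_ ?_ ht
    · intro x _
      have h : HasDerivAt (fun t : ℝ => -(rate / 2) * t) (-(rate / 2)) x := by
        simpa using (hasDerivAt_id x).const_mul (-(rate / 2))
      exact (h.exp.const_mul _).hasDerivWithinAt
    · intro x hx hxe
      have hpos : 0 < V (ζ x) := by
        rw [hxe]; exact mul_pos (by linarith [hVnn (ζ 0)]) (Real.exp_pos _)
      have hle : V (ζ x) < c * r ^ 2 := by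
        rw [hxe]
        refine lt_of_le_of_lt (mul_le_of_le_one_right (by linarith [hVnn (ζ 0)]) ?_) hη'
        rw [Real.exp_le_one_iff]
        nlinarith [hx.1]
      have hb : ζ x ∈ ball p r := by
        rw [mem_ball, dist_eq_norm]
        have := (hlow (ζ x)).trans_lt hle
        have := lt_of_mul_lt_mul_left this hc.le
        exact lt_of_pow_lt_pow_left₀ 2 hr.le this
      have hd := hdec _ hb
      rw [← mul_assoc, ← hxe]
      nlinarith
  have hlim : Tendsto (fun η : ℝ => (V (ζ 0) + η) * Real.exp (-(rate / 2) * t)) (𝓝[>] 0)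
      (𝓝 ((V (ζ 0) + 0) * Real.exp (-(rate / 2) * t))) := by
    refine Tendsto.mono_left ?_ nhdsWithin_le_nhds
    exact (continuous_const.add continuous_id).mul_const _ |>.tendsto 0
  rw [add_zero] at hlim
  refine ge_of_tendsto hlim ?_
  have : Iio (c * r ^ 2 - V (ζ 0)) ∈ 𝓝[>] (0 : ℝ) :=
    mem_nhdsWithin_of_mem_nhds (Iio_mem_nhds (by linarith))
  filter_upwards [this, self_mem_nhdsWithin] with η h1 h2
  exact main η h2 (by have : η < _ := h1; linarith)

/-- Lyapunov's direct method with a quadratically bounded Lyapunov function. -/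
theorem isLocallyExpStable_of_lyapunov [CompleteSpace X] {F : X → X} {D : Set X} {p : X}
    (hp : IsEquilibrium F D p) {r : ℝ} (hr : 0 < r) (hD : ball p r ⊆ D) {K : ℝ≥0}
    (hF : LipschitzOnWith K F (ball p (2 * r)))
    {V : X → ℝ} {V' : X → X →L[ℝ] ℝ} (hV : ∀ s, HasFDerivAt V (V' s) s)
    {c C rate : ℝ} (hc : 0 < c) (hrate : 0 < rate)
    (hlow : ∀ s, c * ‖s - p‖ ^ 2 ≤ V s) (hup : ∀ s, V s ≤ C * ‖s - p‖ ^ 2)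
    (hdec : ∀ s ∈ ball p r, V' s (F s) ≤ -rate * ‖s - p‖ ^ 2) :
    IsLocallyExpStable F D p := by
  -- `C` is not assumed positive; the maximum is.
  set C' := max C c with hC'
  have hC'0 : 0 < C' := lt_max_of_lt_right hc
  have hup' : ∀ s, V s ≤ C' * ‖s - p‖ ^ 2 := fun s =>
    (hup s).trans (mul_le_mul_of_nonneg_right (le_max_left _ _) (sq_nonneg _))
  set ρ := rate / C' with hρ
  have hρ0 : 0 < ρ := div_pos hrate hC'0
  have hdec' : ∀ s ∈ ball p r, V' s (F s) ≤ -ρ * V s := by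
    intro s hs
    refine (hdec s hs).trans ?_
    have h1 : ρ * V s ≤ ρ * (C' * ‖s - p‖ ^ 2) := mul_le_mul_of_nonneg_left (hup' s) hρ0.le
    have h2 : ρ * (C' * ‖s - p‖ ^ 2) = rate * ‖s - p‖ ^ 2 := by
      rw [hρ]; field_simp
    linarith
  set δ := r * Real.sqrt (c / C') with hδ
  have hδ0 : 0 < δ := mul_pos hr (Real.sqrt_pos.2 (div_pos hc hC'0))
  have hstart : ∀ s, ‖s - p‖ < δ → V s < c * r ^ 2 := by
    intro s hs
    have h1 : ‖s - p‖ ^ 2 < δ ^ 2 := pow_lt_pow_left₀ hs (norm_nonneg _) two_ne_zero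
    have h2 : δ ^ 2 = r ^ 2 * (c / C') := by
      rw [hδ, mul_pow, Real.sq_sqrt (div_pos hc hC'0).le]
    calc V s ≤ C' * ‖s - p‖ ^ 2 := hup' s
      _ < C' * δ ^ 2 := mul_lt_mul_of_pos_left h1 hC'0
      _ = c * r ^ 2 := by rw [h2]; field_simp
  have hest : ∀ (s₀ : X) (t : ℝ) (s : X), V s ≤ V s₀ * Real.exp (-(ρ / 2) * t) →
      ‖s - p‖ ≤ Real.sqrt (C' / c) * Real.exp (-(ρ / 4) * t) * ‖s₀ - p‖ := by
    intro s₀ t s h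
    refine le_of_sq_le_sq ?_ (by positivity)
    rw [mul_pow, mul_pow, Real.sq_sqrt (div_pos hC'0 hc).le, ← Real.exp_nat_mul]
    have e : ((2 : ℕ) : ℝ) * (-(ρ / 4) * t) = -(ρ / 2) * t := by push_cast; ring
    rw [e]
    have h1 := hlow s
    have h2 : V s₀ * Real.exp (-(ρ / 2) * t) ≤
        (C' * ‖s₀ - p‖ ^ 2) * Real.exp (-(ρ / 2) * t) :=
      mul_le_mul_of_nonneg_right (hup' s₀) (Real.exp_pos _).le
    have h3 : c * ‖s - p‖ ^ 2 ≤ (C' * ‖s₀ - p‖ ^ 2) * Real.exp (-(ρ / 2) * t) := by linarith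
    have h4 : C' / c * Real.exp (-(ρ / 2) * t) * ‖s₀ - p‖ ^ 2
        = ((C' * ‖s₀ - p‖ ^ 2) * Real.exp (-(ρ / 2) * t)) / c := by ring
    rw [h4, le_div_iff₀ hc]
    linarith
  refine ⟨hp, δ, hδ0, Real.sqrt (C' / c), Real.sqrt_pos.2 (div_pos hC'0 hc), ρ / 4,
    by positivity, fun ζ₀ hζ₀ => ⟨?_, ?_⟩⟩
  -- Solve globally for the modified field; the Lyapunov estimate traps the solution in the
  -- `r`-ball, where the two fields agree.
  · obtain ⟨G, L, K', hGF, hGL, hGK⟩ := exists_bounded_lipschitz_of_lipschitzOn_ball hr hF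
    obtain ⟨ζ, hζ0, hζ⟩ := exists_isIntegralCurveOn_Ici hGL hGK ζ₀
    have hmem : ∀ t ∈ Ici (0 : ℝ), ζ t ∈ ball p r := by
      intro t ht
      have hV0 : V (ζ 0) < c * r ^ 2 := by rw [hζ0]; exact hstart _ hζ₀
      have h := lyapunov_decay hV (F := G) hr hc hρ0 hlow
        (fun s hs => by rw [hGF s hs]; exact hdec' s hs) (ζ := ζ) (T := t)
        (fun x hx => (hζ x hx.1).continuousWithinAt.mono fun y hy => hy.1)
        (fun x hx => (hζ x hx.1).mono fun y hy => le_trans hx.1 hy)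
        hV0 t ⟨ht, le_rfl⟩
      have ht0 : (0 : ℝ) ≤ t := ht
      have h1 : V (ζ 0) * Real.exp (-(ρ / 2) * t) ≤ V (ζ 0) := by
        refine mul_le_of_le_one_right (le_trans (by positivity) (hlow (ζ 0))) ?_
        rw [Real.exp_le_one_iff]
        nlinarith
      have h2 : c * ‖ζ t - p‖ ^ 2 < c * r ^ 2 := ((hlow _).trans (h.trans h1)).trans_lt hV0
      rw [mem_ball, dist_eq_norm]
      exact lt_of_pow_lt_pow_left₀ 2 hr.le (lt_of_mul_lt_mul_left h2 hc.le)
    refine ⟨ζ, hζ0, fun t ht => hD (hmem t ht), fun t ht => ?_⟩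
    have h := hζ t ht
    simp only [hGF _ (hmem t ht)] at h
    exact h
  · intro T ζ hζ0 hζ t ht
    have hV0 : V (ζ 0) < c * r ^ 2 := by rw [hζ0]; exact hstart _ hζ₀
    have hsub : Icc 0 t ⊆ Ico 0 T := fun x hx => ⟨hx.1, hx.2.trans_lt ht.2⟩
    have h := lyapunov_decay hV (F := F) hr hc hρ0 hlow hdec' (ζ := ζ) (T := t)
        (fun x hx => (hζ.2 x (hsub hx)).continuousWithinAt.mono hsub)
        (fun x hx => (hζ.2 x (hsub (Ico_subset_Icc_self hx))).mono_of_mem_nhdsWithin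
          (mem_of_superset (Ico_mem_nhdsGE (hx.2.trans ht.2)) (Ico_subset_Ico_left hx.1)))
        hV0 t ⟨ht.1, le_rfl⟩
    rw [← hζ0]
    exact hest _ _ _ h

end Flow

end OSS

namespace OSS
open Set Filter Topology Metric
open scoped NNReal ENNReal

/-! ### Hurwitz matrices and the Lyapunov inequality -/

section Hurwitz

open scoped Matrix.Norms.Operator in
/-- The powers of a complex matrix with all eigenvalues in the open unit disc tend to zero. -/
lemma tendsto_pow_zero_of_spectrum {n : ℕ} {S : Matrix (Fin n) (Fin n) ℂ}
    (hS : ∀ z ∈ spectrum ℂ S, ‖z‖ < 1) : Tendsto (fun N => S ^ N) atTop (𝓝 0) := by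
  rcases Nat.eq_zero_or_pos n with rfl | hn
  · have : (fun N => S ^ N) = fun _ => 0 := by
      funext N; exact Subsingleton.elim _ _
    rw [this]; exact tendsto_const_nhds
  have : Nonempty (Fin n) := ⟨⟨0, hn⟩⟩
  have h1 : spectralRadius ℂ S < (1 : ℝ≥0) :=
    spectrum.spectralRadius_lt_of_forall_lt S fun z hz => by exact_mod_cast hS z hz
  obtain ⟨q, hq1, hq2⟩ := ENNReal.lt_iff_exists_nnreal_btwn.1 h1
  have hq2' : q < 1 := by exact_mod_cast hq2
  -- Gelfand's formula: the `N`-th roots of `‖S ^ N‖` eventually drop below `q < 1`.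
  have hev := (spectrum.pow_nnnorm_pow_one_div_tendsto_nhds_spectralRadius S).eventually
    (Iio_mem_nhds hq1)
  have hle : ∀ᶠ N : ℕ in atTop, ‖S ^ N‖ ≤ (q : ℝ) ^ N := by
    filter_upwards [hev, eventually_gt_atTop 0] with N hN hN0
    have h2 : ((‖S ^ N‖₊ : ℝ≥0∞) ^ (1 / (N : ℝ))) ^ (N : ℝ) ≤ (q : ℝ≥0∞) ^ (N : ℝ) :=
      ENNReal.rpow_le_rpow (le_of_lt hN) (Nat.cast_nonneg N)
    rw [← ENNReal.rpow_mul, one_div, inv_mul_cancel₀ (by positivity), ENNReal.rpow_one,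
      ENNReal.rpow_natCast] at h2
    have h3 : ‖S ^ N‖₊ ≤ q ^ N := by exact_mod_cast h2
    exact_mod_cast h3
  refine squeeze_zero_norm' hle ?_
  exact tendsto_pow_atTop_nhds_zero_of_lt_one q.2 (by exact_mod_cast hq2')

/-- A short explicit Euler step of a Hurwitz matrix has all eigenvalues in the open unit disc. -/
lemma IsHurwitz.exists_euler_spectrum {n : ℕ} {A : Matrix (Fin n) (Fin n) ℝ} (hA : IsHurwitz A) :
    ∃ h : ℝ, 0 < h ∧
      ∀ z ∈ spectrum ℂ (1 + (h : ℂ) • A.map Complex.ofReal), ‖z‖ < 1 := by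
  have hfin : (spectrum ℂ (A.map Complex.ofReal)).Finite := Matrix.finite_spectrum _
  have hev : ∀ᶠ h : ℝ in 𝓝[>] 0, ∀ s ∈ spectrum ℂ (A.map Complex.ofReal),
      ‖1 + (h : ℂ) * s‖ < 1 := by
    rw [eventually_all_finite hfin]
    intro s hs
    have hre := hA s hs
    -- The bound comes from `‖1 + h s‖² = 1 + h (2 Re s + h ‖s‖²)`; the `+ 1` only keeps the
    -- denominator positive.
    have hpos : 0 < -2 * s.re / (‖s‖ ^ 2 + 1) := by
      apply div_pos <;> nlinarith [sq_nonneg ‖s‖]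
    filter_upwards [Ioo_mem_nhdsGT hpos] with h hh
    obtain ⟨h0, h1⟩ := hh
    rw [lt_div_iff₀ (by positivity)] at h1
    have h2 : ‖1 + (h : ℂ) * s‖ ^ 2 = 1 + h * (2 * s.re + h * ‖s‖ ^ 2) := by
      rw [Complex.sq_norm, Complex.sq_norm, Complex.normSq_apply, Complex.normSq_apply]
      simp
      ring
    have h3 : ‖1 + (h : ℂ) * s‖ ^ 2 < 1 ^ 2 := by
      rw [h2]
      nlinarith
    exact lt_of_pow_lt_pow_left₀ 2 zero_le_one h3
  obtain ⟨h, hh, h0⟩ := (hev.and self_mem_nhdsWithin).exists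
  have h0' : (0 : ℝ) < h := h0
  have hne : (h : ℂ) ≠ 0 := by exact_mod_cast h0'.ne'
  refine ⟨h, h0, fun z hz => ?_⟩
  have hmem : (z - 1) / h ∈ spectrum ℂ (A.map Complex.ofReal) := by
    rw [spectrum.mem_iff] at hz ⊢
    intro hu
    apply hz
    have e : algebraMap ℂ (Matrix (Fin n) (Fin n) ℂ) z - (1 + (h : ℂ) • A.map Complex.ofReal)
        = (Units.mk0 (h : ℂ) hne) •
          (algebraMap ℂ (Matrix (Fin n) (Fin n) ℂ) ((z - 1) / h) - A.map Complex.ofReal) := by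
      rw [Units.smul_def, Units.val_mk0, smul_sub, Algebra.algebraMap_eq_smul_one,
        Algebra.algebraMap_eq_smul_one, smul_smul, mul_div_cancel₀ _ hne, sub_smul, one_smul]
      abel
    rw [e]
    exact (isUnit_smul_iff _ _).2 hu
  have := hh _ hmem
  rwa [mul_div_cancel₀ _ hne, add_sub_cancel] at this

/-- The continuous linear map `v ↦ M v`. -/
noncomputable def actL {k l : ℕ} (M : Matrix (Fin k) (Fin l) ℝ) : Vec l →L[ℝ] Vec k :=
  LinearMap.toContinuousLinearMap (Matrix.toEuclideanLin M)

lemma act_eq_actL {k l : ℕ} (M : Matrix (Fin k) (Fin l) ℝ) (v : Vec l) : act M v = actL M v := rfl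

lemma actL_mul {j k l : ℕ} (M : Matrix (Fin j) (Fin k) ℝ) (N : Matrix (Fin k) (Fin l) ℝ) :
    actL (M * N) = (actL M).comp (actL N) := by
  ext1 v
  simp [actL, Matrix.toLpLin_apply]

lemma actL_add {k l : ℕ} (M N : Matrix (Fin k) (Fin l) ℝ) : actL (M + N) = actL M + actL N := by
  simp [actL]

lemma actL_neg {k l : ℕ} (M : Matrix (Fin k) (Fin l) ℝ) : actL (-M) = -actL M := by
  simp [actL]

lemma actL_smul {k l : ℕ} (c : ℝ) (M : Matrix (Fin k) (Fin l) ℝ) : actL (c • M) = c • actL M := by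
  simp [actL]

lemma actL_one {k : ℕ} : actL (1 : Matrix (Fin k) (Fin k) ℝ) = ContinuousLinearMap.id ℝ _ := by
  ext1 v
  simp [actL]

lemma actL_pow {k : ℕ} (M : Matrix (Fin k) (Fin k) ℝ) (N : ℕ) : actL (M ^ N) = actL M ^ N := by
  induction N with
  | zero => rw [pow_zero, pow_zero, actL_one]; rfl
  | succ N ih => rw [pow_succ, pow_succ, actL_mul, ih]; rfl

lemma actL_transpose {k l : ℕ} (M : Matrix (Fin k) (Fin l) ℝ) :
    actL M.transpose = ContinuousLinearMap.adjoint (actL M) := by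
  rw [ContinuousLinearMap.eq_adjoint_iff]
  intro x y
  simp only [actL, LinearMap.coe_toContinuousLinearMap', Matrix.toLpLin_apply]
  simp [PiLp.inner_apply, Matrix.mulVec, dotProduct, Finset.sum_mul, Finset.mul_sum]
  rw [Finset.sum_comm]
  refine Finset.sum_congr rfl fun i _ => Finset.sum_congr rfl fun j _ => by ring

/-- For a Hurwitz matrix some power of a short explicit Euler step is a contraction. -/
lemma IsHurwitz.exists_euler_contraction {n : ℕ} {A : Matrix (Fin n) (Fin n) ℝ}
    (hA : IsHurwitz A) :
    ∃ h : ℝ, 0 < h ∧ ∃ N : ℕ, 0 < N ∧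
      ‖(ContinuousLinearMap.id ℝ (Vec n) + h • actL A) ^ N‖ ≤ 1 / 2 := by
  obtain ⟨h, h0, hspec⟩ := hA.exists_euler_spectrum
  refine ⟨h, h0, ?_⟩
  have ht := tendsto_pow_zero_of_spectrum hspec
  have hmap : ∀ N : ℕ, (1 + (h : ℂ) • A.map Complex.ofReal) ^ N
      = ((1 + h • A) ^ N).map Complex.ofReal := by
    intro N
    have e : (1 + (h : ℂ) • A.map Complex.ofReal)
        = (Complex.ofRealHom.mapMatrix (1 + h • A)) := by
      rw [map_add, map_one]
      congr 1
      ext i j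
      simp
    rw [e, ← map_pow]
    rfl
  have ht' : Tendsto (fun N => (1 + h • A) ^ N) atTop (𝓝 0) := by
    have h1 : Tendsto (fun N => (((1 + (h : ℂ) • A.map Complex.ofReal) ^ N).map Complex.re))
        atTop (𝓝 ((0 : Matrix (Fin n) (Fin n) ℂ).map Complex.re)) :=
      ((continuous_id.matrix_map Complex.continuous_re).tendsto 0).comp ht
    have e0 : ((0 : Matrix (Fin n) (Fin n) ℂ).map Complex.re) = 0 := by ext; simp
    rw [e0] at h1
    refine h1.congr fun N => ?_
    rw [hmap]
    ext i j
    simp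
  let ℓ : Matrix (Fin n) (Fin n) ℝ →ₗ[ℝ] (Vec n →L[ℝ] Vec n) :=
    { toFun := actL, map_add' := actL_add, map_smul' := actL_smul }
  have hc : Continuous fun M => ‖ℓ M‖ :=
    (LinearMap.continuous_of_finiteDimensional ℓ).norm
  have ht2 : Tendsto (fun N => ‖ℓ ((1 + h • A) ^ N)‖) atTop (𝓝 ‖ℓ 0‖) := (hc.tendsto 0).comp ht'
  rw [map_zero, norm_zero] at ht2
  obtain ⟨N, hN, hN0⟩ :=
    ((ht2.eventually (Iio_mem_nhds (show (0 : ℝ) < 1 / 2 by norm_num))).and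
      (eventually_gt_atTop 0)).exists
  refine ⟨N, hN0, ?_⟩
  have e : ℓ ((1 + h • A) ^ N) = (ContinuousLinearMap.id ℝ (Vec n) + h • actL A) ^ N := by
    change actL _ = _
    rw [actL_pow, actL_add, actL_one, actL_smul]
  rw [e] at hN
  exact le_of_lt hN

open scoped RealInnerProductSpace

/-- **Lyapunov's theorem**: a Hurwitz matrix is dissipative for some inner product. -/
theorem IsHurwitz.exists_lyapunov {n : ℕ} {A : Matrix (Fin n) (Fin n) ℝ} (hA : IsHurwitz A) :
    ∃ P : Vec n →L[ℝ] Vec n, (∀ x y, ⟪P x, y⟫ = ⟪x, P y⟫) ∧ (∀ y, ‖y‖ ^ 2 ≤ ⟪P y, y⟫) ∧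
      ∃ k > 0, ∀ y, ⟪P y, actL A y⟫ ≤ -k * ‖y‖ ^ 2 := by
  obtain ⟨h, h0, N, hN0, hN⟩ := hA.exists_euler_contraction
  set S := ContinuousLinearMap.id ℝ (Vec n) + h • actL A with hS
  -- A truncated discrete Lyapunov sum: one step of `S` changes its quadratic form by the telescoped
  -- `‖S^N y‖² - ‖y‖²`.
  set P : Vec n →L[ℝ] Vec n :=
    ∑ i ∈ Finset.range N, (ContinuousLinearMap.adjoint (S ^ i)).comp (S ^ i) with hP
  have hPi : ∀ x y, ⟪P x, y⟫ = ∑ i ∈ Finset.range N, ⟪(S ^ i) x, (S ^ i) y⟫ := by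
    intro x y
    simp [hP, sum_inner, ContinuousLinearMap.adjoint_inner_left]
  have hPs : ∀ x y, ⟪P x, y⟫ = ⟪x, P y⟫ := by
    intro x y
    rw [hPi, real_inner_comm, hPi]
    exact Finset.sum_congr rfl fun i _ => real_inner_comm _ _
  have hPq : ∀ y, ⟪P y, y⟫ = ∑ i ∈ Finset.range N, ‖(S ^ i) y‖ ^ 2 := by
    intro y
    rw [hPi]
    exact Finset.sum_congr rfl fun i _ => real_inner_self_eq_norm_sq _
  have hstep : ∀ y, ⟪P (S y), S y⟫ = ⟪P y, y⟫ + ‖(S ^ N) y‖ ^ 2 - ‖y‖ ^ 2 := by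
    intro y
    have e : ∀ i, (S ^ i) (S y) = (S ^ (i + 1)) y := fun i => by rw [pow_succ]; rfl
    rw [hPq, hPq]
    simp_rw [e]
    have h1 := Finset.sum_range_succ (fun i => ‖(S ^ i) y‖ ^ 2) N
    have h2 := Finset.sum_range_succ' (fun i => ‖(S ^ i) y‖ ^ 2) N
    have h3 : (S ^ 0) y = y := rfl
    rw [h3] at h2
    linarith
  have hnn : ∀ y, 0 ≤ ⟪P y, y⟫ := fun y => by rw [hPq]; positivity
  -- Expanding the form at `S y = y + h A y` and dropping the nonnegative `h²` term gives `2h⟨P y, A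
  -- y⟩ ≤ (1/4 - 1)‖y‖²`, whence `3 / (8 * h)`.
  refine ⟨P, hPs, fun y => ?_, 3 / (8 * h), by positivity, fun y => ?_⟩
  · rw [hPq]
    have h3 : ‖(S ^ 0) y‖ ^ 2 = ‖y‖ ^ 2 := by rw [pow_zero]; rfl
    rw [← h3]
    exact Finset.single_le_sum (f := fun i => ‖(S ^ i) y‖ ^ 2) (fun i _ => sq_nonneg _)
      (Finset.mem_range.2 hN0)
  · have h1 := hstep y
    have h2 : S y = y + h • actL A y := by simp [hS]
    have h3 : ‖(S ^ N) y‖ ^ 2 ≤ (1 / 4) * ‖y‖ ^ 2 := by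
      have : ‖(S ^ N) y‖ ≤ 1 / 2 * ‖y‖ := (S ^ N).le_of_opNorm_le hN y
      nlinarith [norm_nonneg ((S ^ N) y)]
    have h4 : ⟪P (S y), S y⟫ = ⟪P y, y⟫ + 2 * h * ⟪P y, actL A y⟫
        + h ^ 2 * ⟪P (actL A y), actL A y⟫ := by
      rw [h2, map_add, map_smul, inner_add_left, inner_add_right, inner_add_right,
        real_inner_smul_left, real_inner_smul_left, real_inner_smul_right, real_inner_smul_right,
        hPs (actL A y) y, real_inner_comm (P y) (actL A y)]
      ring
    have h5 := hnn (actL A y)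
    have h6 : 2 * h * ⟪P y, actL A y⟫ ≤ -(3 / 4) * ‖y‖ ^ 2 := by nlinarith [sq_nonneg h]
    have e : -(3 / (8 * h)) * ‖y‖ ^ 2 = (-(3 / 4) * ‖y‖ ^ 2) / (2 * h) := by
      field_simp; ring
    rw [e, le_div_iff₀ (by positivity)]
    linarith

/-- Zero is not in the open left half-plane. This makes the `A⁻¹` in the DC gains a genuine inverse.
-/
lemma IsHurwitz.isUnit {n : ℕ} {A : Matrix (Fin n) (Fin n) ℝ} (hA : IsHurwitz A) : IsUnit A := by
  rw [Matrix.isUnit_iff_isUnit_det, isUnit_iff_ne_zero]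
  intro hdet
  have h0 : (0 : ℂ) ∈ spectrum ℂ (A.map Complex.ofReal) := by
    rw [spectrum.zero_mem_iff, Matrix.isUnit_iff_isUnit_det, isUnit_iff_ne_zero, not_not]
    have := (Complex.ofRealHom.map_det A).symm
    rw [hdet, map_zero] at this
    exact this
  simpa using hA 0 h0

end Hurwitz

end OSS

namespace OSS
open Set Filter Topology Metric
open scoped NNReal RealInnerProductSpace

/-! ### The composite Lyapunov function of the loop -/

section Lyapunov

/-- The scalar inequality behind the decrease of the Lyapunov function. -/
lemma decrease_scalar {K k κ σ c τs τp ρ β Y U N : ℝ} (hK : 1 ≤ K) (hk : 0 < k) (hκ : 0 < κ)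
    (hσ : 0 < σ) (hc1 : c ≤ 1) (hc2 : 4 * c * K ^ 4 ≤ κ * σ)
    (hc3 : 4 * c * K ^ 2 ≤ κ) (hs1 : 2 * K ^ 2 + 16 * K ^ 4 / κ ≤ k * τs)
    (hs2 : 32 * K ^ 4 / (σ * k) ≤ c * τs) (hτ : τs ≤ τp) (hρ0 : 0 < ρ) (hρ : ρ ≤ c)
    (hβ : β ≤ c) (hρτ : c * τs ≤ ρ * τp) (hY : 0 ≤ Y) (hU : 0 ≤ U) (hN : 0 ≤ N) :
    -(2 * τp * k) * Y ^ 2 + 2 * K ^ 2 * Y * (U + N + Y) + (-κ * U ^ 2 + K * U * Y) + K * Y * N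
      + ρ * (K ^ 2 * (U + Y) * N - σ * N ^ 2) + β * (K ^ 2 * U ^ 2 + K ^ 2 * U * Y)
      ≤ -(min (k * τp / 2) (min (κ / 4) (ρ * σ / 2))) * (Y ^ 2 + U ^ 2 + N ^ 2) := by
  have hK2 : K ≤ K ^ 2 := by nlinarith
  have hUY : 0 ≤ U * Y := mul_nonneg hU hY
  have hYN : 0 ≤ Y * N := mul_nonneg hY hN
  have hτK : 0 < 2 * K ^ 2 + 16 * K ^ 4 / κ := by positivity
  -- The factor `4 * K ^ 2` covers the three cross terms of each kind, `2K² + K + K²`. They use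
  -- three quarters of `κ U²`, half of `ρ σ N²` and three quarters of `2 τp k Y²`; the rest is the
  -- decay rate.
  have young : ∀ a p q : ℝ, 0 < a → 4 * K ^ 2 * (p * q) ≤ a / 4 * p ^ 2 + 16 * K ^ 4 / a * q ^ 2 := by
    intro a p q ha
    have e : a / 4 * p ^ 2 + 16 * K ^ 4 / a * q ^ 2 - 4 * K ^ 2 * (p * q)
        = (a * p - 8 * K ^ 2 * q) ^ 2 / (4 * a) := by
      field_simp; ring
    have : 0 ≤ (a * p - 8 * K ^ 2 * q) ^ 2 / (4 * a) := by positivity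
    linarith
  have t1 : 2 * K ^ 2 * Y * U + K * U * Y + β * (K ^ 2 * U * Y)
      ≤ κ / 4 * U ^ 2 + 16 * K ^ 4 / κ * Y ^ 2 := by
    refine le_trans ?_ (young κ U Y hκ)
    have h1 : K * (U * Y) ≤ K ^ 2 * (U * Y) := by gcongr
    have h2 : β * (K ^ 2 * (U * Y)) ≤ 1 * (K ^ 2 * (U * Y)) :=
      mul_le_mul_of_nonneg_right (hβ.trans hc1) (by positivity)
    linarith
  have t2 : 2 * K ^ 2 * Y * N + K * Y * N + ρ * (K ^ 2 * Y * N)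
      ≤ ρ * σ / 4 * N ^ 2 + 16 * K ^ 4 / (ρ * σ) * Y ^ 2 := by
    refine le_trans ?_ (young (ρ * σ) N Y (by positivity))
    have h1 : K * (Y * N) ≤ K ^ 2 * (Y * N) := by gcongr
    have h2 : ρ * (K ^ 2 * (Y * N)) ≤ 1 * (K ^ 2 * (Y * N)) :=
      mul_le_mul_of_nonneg_right (hρ.trans hc1) (by positivity)
    linarith
  have t3 : ρ * (K ^ 2 * U * N) ≤ ρ * σ / 4 * N ^ 2 + κ / 4 * U ^ 2 := by
    have h1 : K ^ 2 * U * N ≤ σ / 4 * N ^ 2 + K ^ 4 / σ * U ^ 2 := by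
      have e : σ / 4 * N ^ 2 + K ^ 4 / σ * U ^ 2 - K ^ 2 * U * N
          = (σ * N - 2 * K ^ 2 * U) ^ 2 / (4 * σ) := by
        field_simp; ring
      have : 0 ≤ (σ * N - 2 * K ^ 2 * U) ^ 2 / (4 * σ) := by positivity
      linarith
    have h2 : ρ * (K ^ 4 / σ) ≤ κ / 4 := by
      rw [mul_div_assoc', div_le_iff₀ hσ]
      have : ρ * K ^ 4 ≤ c * K ^ 4 := by gcongr
      linarith
    have h3 : ρ * (K ^ 4 / σ) * U ^ 2 ≤ κ / 4 * U ^ 2 := by gcongr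
    have h4 : ρ * (K ^ 2 * U * N) ≤ ρ * (σ / 4 * N ^ 2 + K ^ 4 / σ * U ^ 2) := by gcongr
    linarith
  have t4 : β * (K ^ 2 * U ^ 2) ≤ κ / 4 * U ^ 2 := by
    have h1 : β * K ^ 2 ≤ c * K ^ 2 := by gcongr
    have h2 : β * K ^ 2 * U ^ 2 ≤ κ / 4 * U ^ 2 := by gcongr; linarith
    linarith
  -- When `τd` is far below `τp` the factor `ρ` is small, but `ρ * τp` stays above `c * τs`, which
  -- is all that is needed.
  have t5 : 2 * K ^ 2 + 16 * K ^ 4 / κ + 16 * K ^ 4 / (ρ * σ) ≤ k * τp + k * τp / 2 := by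
    have h1 : k * τs ≤ k * τp := by gcongr
    have h2 : 16 * K ^ 4 / (ρ * σ) ≤ k * τp / 2 := by
      have h3 := hs2.trans hρτ
      rw [div_le_iff₀ (by positivity)] at h3 ⊢
      nlinarith
    linarith
  have t6 : (2 * K ^ 2 + 16 * K ^ 4 / κ + 16 * K ^ 4 / (ρ * σ)) * Y ^ 2
      ≤ (k * τp + k * τp / 2) * Y ^ 2 := by gcongr
  set l := min (k * τp / 2) (min (κ / 4) (ρ * σ / 2)) with hl
  have l1 : l * Y ^ 2 ≤ k * τp / 2 * Y ^ 2 := by gcongr; exact min_le_left _ _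
  have l2 : l * U ^ 2 ≤ κ / 4 * U ^ 2 := by
    gcongr; exact (min_le_right _ _).trans (min_le_left _ _)
  have l3 : l * N ^ 2 ≤ ρ * σ / 2 * N ^ 2 := by
    gcongr; exact (min_le_right _ _).trans (min_le_right _ _)
  linarith

/-- The shear `(x, u, μ) ↦ (x + Q u, u, μ)` has a bounded inverse, so estimates in sheared
coordinates carry over to the sup norm of the product. -/
lemma norm_sq_le_deviation {E F H : Type*} [NormedAddCommGroup E] [NormedSpace ℝ E]
    [NormedAddCommGroup F] [NormedSpace ℝ F] [NormedAddCommGroup H] (Q : F →L[ℝ] E) (e : E × F × H) :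
    ‖e‖ ^ 2 ≤ (2 + 2 * ‖Q‖ ^ 2) *
      (‖e.1 + Q e.2.1‖ ^ 2 + ‖e.2.1‖ ^ 2 + ‖e.2.2‖ ^ 2) := by
  have hx : ‖e.1‖ ≤ ‖e.1 + Q e.2.1‖ + ‖Q‖ * ‖e.2.1‖ := by
    calc ‖e.1‖ = ‖(e.1 + Q e.2.1) - Q e.2.1‖ := by rw [add_sub_cancel_right]
      _ ≤ ‖e.1 + Q e.2.1‖ + ‖Q e.2.1‖ := norm_sub_le _ _
      _ ≤ _ := by gcongr; exact Q.le_opNorm _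
  set Y := ‖e.1 + Q e.2.1‖
  set U := ‖e.2.1‖ with hU
  set N := ‖e.2.2‖ with hN
  have hx2 : ‖e.1‖ ^ 2 ≤ (Y + ‖Q‖ * U) ^ 2 := by gcongr
  have p1 : 0 ≤ ‖Q‖ ^ 2 * Y ^ 2 := by positivity
  have p2 : 0 ≤ ‖Q‖ ^ 2 * U ^ 2 := by positivity
  have p3 : 0 ≤ ‖Q‖ ^ 2 * N ^ 2 := by positivity
  have hm : ‖e‖ = max ‖e.1‖ (max U N) := rfl
  rw [hm]
  rcases max_choice ‖e.1‖ (max U N) with h | h <;> rw [h]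
  · nlinarith [sq_nonneg (Y - ‖Q‖ * U), sq_nonneg U, sq_nonneg N]
  · rcases max_choice U N with h | h <;> rw [h] <;>
      nlinarith [sq_nonneg Y, sq_nonneg U, sq_nonneg N]

variable {E F H : Type*} [NormedAddCommGroup E] [InnerProductSpace ℝ E]
  [NormedAddCommGroup F] [InnerProductSpace ℝ F]
  [NormedAddCommGroup H] [InnerProductSpace ℝ H]

/-- The Lyapunov function of the primal-dual loop, in deviations from equilibrium. -/
noncomputable def loopLyapunov (P : E →L[ℝ] E) (Q : F →L[ℝ] E) (M : F →L[ℝ] H) (τp τd ε : ℝ)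
    (e : E × F × H) : ℝ :=
  τp * ⟪P (e.1 + Q e.2.1), e.1 + Q e.2.1⟫ + τp / 2 * ⟪e.2.1, e.2.1⟫ + τd / 2 * ⟪e.2.2, e.2.2⟫
    + ε * ⟪M e.2.1, e.2.2⟫

lemma loopLyapunov_hasFDerivAt {P : E →L[ℝ] E} (hP : ∀ x y, ⟪P x, y⟫ = ⟪x, P y⟫)
    (Q : F →L[ℝ] E) (M : F →L[ℝ] H) (τp τd ε : ℝ) (e : E × F × H) :
    ∃ V' : E × F × H →L[ℝ] ℝ, HasFDerivAt (loopLyapunov P Q M τp τd ε) V' e ∧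
      ∀ v, V' v = 2 * τp * ⟪P (e.1 + Q e.2.1), v.1 + Q v.2.1⟫ + τp * ⟪e.2.1, v.2.1⟫
        + τd * ⟪e.2.2, v.2.2⟫ + ε * (⟪M v.2.1, e.2.2⟫ + ⟪M e.2.1, v.2.2⟫) := by
  have h1 : HasFDerivAt (fun e : E × F × H => e.1)
    (ContinuousLinearMap.fst ℝ E (F × H)) e := hasFDerivAt_fst
  have hs : HasFDerivAt (fun e : E × F × H => e.2)
    (ContinuousLinearMap.snd ℝ E (F × H)) e := hasFDerivAt_snd
  have h2 := hs.fst
  have h3 := hs.snd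
  have hy := h1.add (Q.hasFDerivAt.comp e h2)
  have d1 := ((P.hasFDerivAt.comp e hy).inner ℝ hy).const_mul τp
  have d2 := (h2.inner ℝ h2).const_mul (τp / 2)
  have d3 := (h3.inner ℝ h3).const_mul (τd / 2)
  have d4 := ((M.hasFDerivAt.comp e h2).inner ℝ h3).const_mul ε
  refine ⟨_, ((d1.add d2).add d3).add d4, fun v => ?_⟩
  have c1 := real_inner_comm v.2.1 e.2.1
  have c2 := real_inner_comm v.2.2 e.2.2
  have c3 := (hP (v.1 + Q v.2.1) (e.1 + Q e.2.1)).trans (real_inner_comm _ _)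
  simp at c1 c2 c3 ⊢
  rw [c1, c2, c3]
  ring

/-- Scaling the cross term with the smaller time constant, with `4 * c * K ≤ 1`, lets the squares of
`u` and `μ` dominate it. -/
lemma loopLyapunov_lower {P : E →L[ℝ] E} (hP : ∀ y, ‖y‖ ^ 2 ≤ ⟪P y, y⟫)
    (Q : F →L[ℝ] E) (M : F →L[ℝ] H) {K c τp τd : ℝ} (hM : ‖M‖ ≤ K) (hc0 : 0 ≤ c)
    (hc : 4 * c * K ≤ 1) (hτp : 0 < τp) (hτd : 0 < τd) (e : E × F × H) :
    min τp τd / 4 / (2 + 2 * ‖Q‖ ^ 2) * ‖e‖ ^ 2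
      ≤ loopLyapunov P Q M τp τd (c * min τp τd) e := by
  have h1 := norm_sq_le_deviation Q e
  have hm : 0 < min τp τd := lt_min hτp hτd
  rw [div_mul_eq_mul_div, div_le_iff₀ (by positivity)]
  refine (mul_le_mul_of_nonneg_left h1 (by positivity)).trans ?_
  rw [mul_left_comm, mul_comm]
  refine mul_le_mul_of_nonneg_right ?_ (by positivity)
  rw [loopLyapunov, real_inner_self_eq_norm_sq, real_inner_self_eq_norm_sq]
  have h2 := hP (e.1 + Q e.2.1)
  have h3 : |⟪M e.2.1, e.2.2⟫| ≤ K * ‖e.2.1‖ * ‖e.2.2‖ :=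
    (abs_real_inner_le_norm _ _).trans (by gcongr; exact M.le_of_opNorm_le hM _)
  set Y := ‖e.1 + Q e.2.1‖
  set U := ‖e.2.1‖
  set N := ‖e.2.2‖
  set m := min τp τd
  have hmp : m ≤ τp := min_le_left _ _
  have hmd : m ≤ τd := min_le_right _ _
  have h4 : -(c * m * (K * U * N)) ≤ c * m * ⟪M e.2.1, e.2.2⟫ := by
    rw [← mul_neg]
    exact mul_le_mul_of_nonneg_left (neg_le_of_abs_le h3) (by positivity)
  have h5 : 4 * c * K * (m * (U * N)) ≤ 1 * (m * (U * N)) :=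
    mul_le_mul_of_nonneg_right hc (by positivity)
  have h6 : m * (2 * (U * N)) ≤ m * (U ^ 2 + N ^ 2) :=
    mul_le_mul_of_nonneg_left (by nlinarith [sq_nonneg (U - N)]) hm.le
  have h7 : m * Y ^ 2 ≤ τp * ⟪P (e.1 + Q e.2.1), e.1 + Q e.2.1⟫ := by gcongr
  have h8 : m * U ^ 2 ≤ τp * U ^ 2 := by gcongr
  have h9 : m * N ^ 2 ≤ τd * N ^ 2 := by gcongr
  have : 0 ≤ m * Y ^ 2 := by positivity
  have : 0 ≤ m * U ^ 2 := by positivity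
  have : 0 ≤ m * N ^ 2 := by positivity
  linarith

lemma loopLyapunov_upper (P : E →L[ℝ] E) (Q : F →L[ℝ] E) (M : F →L[ℝ] H) {τp τd ε : ℝ}
    (hτp : 0 ≤ τp) (hτd : 0 ≤ τd) (hε : 0 ≤ ε) (e : E × F × H) :
    loopLyapunov P Q M τp τd ε e ≤
      (τp * (‖P‖ * (1 + ‖Q‖) ^ 2) + τp / 2 + τd / 2 + ε * ‖M‖) * ‖e‖ ^ 2 := by
  have hx : ‖e.1‖ ≤ ‖e‖ := norm_fst_le e
  have hu : ‖e.2.1‖ ≤ ‖e‖ := (norm_fst_le e.2).trans (norm_snd_le e)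
  have hn : ‖e.2.2‖ ≤ ‖e‖ := (norm_snd_le e.2).trans (norm_snd_le e)
  have hy : ‖e.1 + Q e.2.1‖ ≤ (1 + ‖Q‖) * ‖e‖ := by
    calc _ ≤ ‖e.1‖ + ‖Q e.2.1‖ := norm_add_le _ _
      _ ≤ ‖e‖ + ‖Q‖ * ‖e‖ := by gcongr; exact Q.le_opNorm_of_le hu
      _ = _ := by ring
  have h1 : ⟪P (e.1 + Q e.2.1), e.1 + Q e.2.1⟫ ≤ ‖P‖ * ((1 + ‖Q‖) * ‖e‖) * ((1 + ‖Q‖) * ‖e‖) :=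
    (real_inner_le_norm _ _).trans (by gcongr; exact P.le_opNorm_of_le hy)
  have h2 : ⟪M e.2.1, e.2.2⟫ ≤ ‖M‖ * ‖e‖ * ‖e‖ :=
    (real_inner_le_norm _ _).trans (by gcongr; exact M.le_opNorm_of_le hu)
  rw [loopLyapunov, real_inner_self_eq_norm_sq, real_inner_self_eq_norm_sq]
  calc _ ≤ τp * (‖P‖ * ((1 + ‖Q‖) * ‖e‖) * ((1 + ‖Q‖) * ‖e‖)) + τp / 2 * ‖e‖ ^ 2
        + τd / 2 * ‖e‖ ^ 2 + ε * (‖M‖ * ‖e‖ * ‖e‖) := by gcongr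
    _ = _ := by ring

/-- The decrease of the Lyapunov function, for deviations `(y, u, μ)` with time derivatives
`A y + Q v`, `v` and `η`. -/
lemma loopLyapunov_decrease [CompleteSpace F] [CompleteSpace H] {P A : E →L[ℝ] E} {Q : F →L[ℝ] E} {M : F →L[ℝ] H} {S : E →L[ℝ] H}
    {K k κ σ c τs τp τd : ℝ} (hK : 1 ≤ K) (hk : 0 < k) (hκ : 0 < κ) (hσ : 0 < σ) (hc0 : 0 < c)
    (hc1 : c ≤ 1) (hc2 : 4 * c * K ^ 4 ≤ κ * σ) (hc3 : 4 * c * K ^ 2 ≤ κ)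
    (hs1 : 2 * K ^ 2 + 16 * K ^ 4 / κ ≤ k * τs) (hs2 : 32 * K ^ 4 / (σ * k) ≤ c * τs)
    (hs0 : 0 < τs) (hτp : τs ≤ τp) (hτd : τs ≤ τd)
    (hPA : ∀ y, ⟪P y, A y⟫ ≤ -k * ‖y‖ ^ 2) (hPQ : ‖P‖ * ‖Q‖ ≤ K) (hM : ‖M‖ ≤ K) (hS : ‖S‖ ≤ K)
    (hMσ : ∀ μ, σ * ‖μ‖ ^ 2 ≤ ‖M.adjoint μ‖ ^ 2)
    {y : E} {u v g d : F} {μ η : H} (hv : τp • v = -g - M.adjoint μ - d)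
    (hη : τd • η = M u + S y) (hgu : κ * ‖u‖ ^ 2 ≤ ⟪g, u⟫) (hg : ‖g‖ ≤ K * ‖u‖)
    (hd : ‖d‖ ≤ K * ‖y‖) :
    2 * τp * ⟪P y, A y + Q v⟫ + τp * ⟪u, v⟫ + τd * ⟪μ, η⟫
        + c * min τp τd * (⟪M v, μ⟫ + ⟪M u, η⟫)
      ≤ -(min (k * τp / 2) (min (κ / 4) (c * min τp τd / τp * σ / 2))) *
        (‖y‖ ^ 2 + ‖u‖ ^ 2 + ‖μ‖ ^ 2) := by
  have hp0 : 0 < τp := hs0.trans_le hτp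
  have hd0 : 0 < τd := hs0.trans_le hτd
  have hm0 : 0 < min τp τd := lt_min hp0 hd0
  have hms : τs ≤ min τp τd := le_min hτp hτd
  have key := decrease_scalar (K := K) (k := k) (κ := κ) (σ := σ) (c := c) (τs := τs) (τp := τp)
    (ρ := c * min τp τd / τp) (β := c * min τp τd / τd) (Y := ‖y‖) (U := ‖u‖) (N := ‖μ‖)
    hK hk hκ hσ hc1 hc2 hc3 hs1 hs2 hτp (by positivity)
    (by rw [div_le_iff₀ hp0]; gcongr; exact min_le_left _ _)
    (by rw [div_le_iff₀ hd0]; gcongr; exact min_le_right _ _)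
    (by rw [div_mul_cancel₀ _ hp0.ne']; gcongr) (norm_nonneg _) (norm_nonneg _) (norm_nonneg _)
  refine le_trans ?_ key
  have hK0 : 0 ≤ K := by linarith
  have hMa : ‖M.adjoint‖ ≤ K := by
    rw [LinearIsometryEquiv.norm_map]; exact hM
  have hMμ : ‖M.adjoint μ‖ ≤ K * ‖μ‖ := M.adjoint.le_of_opNorm_le hMa _
  have hMu : ‖M u‖ ≤ K * ‖u‖ := M.le_of_opNorm_le hM _
  have hSy : ‖S y‖ ≤ K * ‖y‖ := S.le_of_opNorm_le hS _
  -- The scaled velocity has a bound free of `τp`; this is why large time constants make the drift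
  -- of the quasi-steady state harmless.
  have hvn : ‖τp • v‖ ≤ K * (‖u‖ + ‖μ‖ + ‖y‖) := by
    rw [hv]
    calc _ ≤ ‖-g‖ + ‖M.adjoint μ‖ + ‖d‖ :=
          (norm_sub_le _ _).trans (by gcongr; exact norm_sub_le _ _)
      _ ≤ K * ‖u‖ + K * ‖μ‖ + K * ‖y‖ := by rw [norm_neg]; gcongr
      _ = _ := by ring
  have b1 : 2 * τp * ⟪P y, A y + Q v⟫
      ≤ -(2 * τp * k) * ‖y‖ ^ 2 + 2 * K ^ 2 * ‖y‖ * (‖u‖ + ‖μ‖ + ‖y‖) := by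
    have h1 : ⟪P y, Q (τp • v)⟫ ≤ K * ‖y‖ * (K * (‖u‖ + ‖μ‖ + ‖y‖)) := by
      calc _ ≤ ‖P y‖ * ‖Q (τp • v)‖ := real_inner_le_norm _ _
        _ ≤ (‖P‖ * ‖y‖) * (‖Q‖ * ‖τp • v‖) := by
          gcongr
          · exact P.le_opNorm _
          · exact Q.le_opNorm _
        _ = (‖P‖ * ‖Q‖) * ‖y‖ * ‖τp • v‖ := by ring
        _ ≤ _ := by gcongr
    have h2 := mul_le_mul_of_nonneg_left (hPA y) (show 0 ≤ 2 * τp by positivity)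
    rw [map_smul, real_inner_smul_right] at h1
    rw [inner_add_right]
    nlinarith
  -- The couplings `⟪M u, μ⟫` cancel between the primal and dual parts.
  have b2 : τp * ⟪u, v⟫ + τd * ⟪μ, η⟫ ≤ (-κ * ‖u‖ ^ 2 + K * ‖u‖ * ‖y‖) + K * ‖y‖ * ‖μ‖ := by
    rw [← real_inner_smul_right, ← real_inner_smul_right, hv, hη, inner_sub_right,
      inner_sub_right, inner_neg_right, inner_add_right, ContinuousLinearMap.adjoint_inner_right,
      real_inner_comm (M u) μ, real_inner_comm g u]
    have h1 : -⟪u, d⟫ ≤ ‖u‖ * (K * ‖y‖) :=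
      (neg_le_abs _).trans ((abs_real_inner_le_norm _ _).trans (by gcongr))
    have h2 : ⟪μ, S y⟫ ≤ ‖μ‖ * (K * ‖y‖) := (real_inner_le_norm _ _).trans (by gcongr)
    linarith
  -- The only source of decay in `μ`.
  have b3 : τp * ⟪M v, μ⟫ ≤ K ^ 2 * (‖u‖ + ‖y‖) * ‖μ‖ - σ * ‖μ‖ ^ 2 := by
    rw [← real_inner_smul_left, ← map_smul, ← ContinuousLinearMap.adjoint_inner_right, hv,
      inner_sub_left, inner_sub_left, inner_neg_left, real_inner_self_eq_norm_sq]
    have h1 : -⟪g, M.adjoint μ⟫ ≤ (K * ‖u‖) * (K * ‖μ‖) :=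
      (neg_le_abs _).trans ((abs_real_inner_le_norm _ _).trans (by gcongr))
    have h2 : -⟪d, M.adjoint μ⟫ ≤ (K * ‖y‖) * (K * ‖μ‖) :=
      (neg_le_abs _).trans ((abs_real_inner_le_norm _ _).trans (by gcongr))
    have := hMσ μ
    linarith
  have b4 : τd * ⟪M u, η⟫ ≤ K ^ 2 * ‖u‖ ^ 2 + K ^ 2 * ‖u‖ * ‖y‖ := by
    rw [← real_inner_smul_right, hη, inner_add_right]
    have h1 : ⟪M u, M u⟫ ≤ (K * ‖u‖) * (K * ‖u‖) :=
      (real_inner_le_norm _ _).trans (by gcongr)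
    have h2 : ⟪M u, S y⟫ ≤ (K * ‖u‖) * (K * ‖y‖) :=
      (real_inner_le_norm _ _).trans (by gcongr)
    linarith
  have b3' : c * min τp τd * ⟪M v, μ⟫
      ≤ c * min τp τd / τp * (K ^ 2 * (‖u‖ + ‖y‖) * ‖μ‖ - σ * ‖μ‖ ^ 2) := by
    have e : c * min τp τd * ⟪M v, μ⟫ = c * min τp τd / τp * (τp * ⟪M v, μ⟫) := by field_simp
    rw [e]
    gcongr
  have b4' : c * min τp τd * ⟪M u, η⟫
      ≤ c * min τp τd / τd * (K ^ 2 * ‖u‖ ^ 2 + K ^ 2 * ‖u‖ * ‖y‖) := by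
    have e : c * min τp τd * ⟪M u, η⟫ = c * min τp τd / τd * (τd * ⟪M u, η⟫) := by field_simp
    rw [e]
    gcongr
  linarith

/-- For all sufficiently large time constants the loop of a stable linear system with a strongly
monotone primal-dual flow has a quadratically bounded Lyapunov function. -/
theorem exists_loop_lyapunov [CompleteSpace F] [CompleteSpace H] {P A : E →L[ℝ] E} (hPs : ∀ x y, ⟪P x, y⟫ = ⟪x, P y⟫)
    (hPl : ∀ y, ‖y‖ ^ 2 ≤ ⟪P y, y⟫) {k : ℝ} (hk : 0 < k)
    (hPA : ∀ y, ⟪P y, A y⟫ ≤ -k * ‖y‖ ^ 2) (Q : F →L[ℝ] E) (M : F →L[ℝ] H) (S : E →L[ℝ] H)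
    {σ : ℝ} (hσ : 0 < σ) (hMσ : ∀ μ, σ * ‖μ‖ ^ 2 ≤ ‖M.adjoint μ‖ ^ 2)
    {κ : ℝ} (hκ : 0 < κ) (L : ℝ) :
    ∃ τs > 0, ∀ τp τd : ℝ, τs < τp → τs < τd →
      ∃ (V : E × F × H → ℝ) (V' : E × F × H → E × F × H →L[ℝ] ℝ) (c C rate : ℝ),
        0 < c ∧ 0 < rate ∧ (∀ e, HasFDerivAt V (V' e) e) ∧
        (∀ e, c * ‖e‖ ^ 2 ≤ V e) ∧ (∀ e, V e ≤ C * ‖e‖ ^ 2) ∧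
        ∀ (e v : E × F × H) (g d : F), v.1 + Q v.2.1 = A (e.1 + Q e.2.1) + Q v.2.1 →
          τp • v.2.1 = -g - M.adjoint e.2.2 - d → τd • v.2.2 = M e.2.1 + S (e.1 + Q e.2.1) →
          κ * ‖e.2.1‖ ^ 2 ≤ ⟪g, e.2.1⟫ → ‖g‖ ≤ L * ‖e.2.1‖ → ‖d‖ ≤ L * ‖e.1 + Q e.2.1‖ →
          V' e v ≤ -rate * ‖e‖ ^ 2 := by
  obtain ⟨K, hK⟩ : ∃ K : ℝ, 1 ≤ K ∧ ‖P‖ * ‖Q‖ ≤ K ∧ ‖M‖ ≤ K ∧ ‖S‖ ≤ K ∧ L ≤ K :=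
    ⟨max 1 (max (‖P‖ * ‖Q‖) (max ‖M‖ (max ‖S‖ L))), by simp⟩
  obtain ⟨hK1, hKPQ, hKM, hKS, hKL⟩ := hK
  have hK0 : 0 < K := by linarith
  obtain ⟨c, hc0, hc1, hc2, hc3, hc4⟩ : ∃ c : ℝ, 0 < c ∧ c ≤ 1 ∧ 4 * c * K ^ 4 ≤ κ * σ ∧
      4 * c * K ^ 2 ≤ κ ∧ 4 * c * K ≤ 1 := by
    refine ⟨min 1 (min (κ * σ / (4 * K ^ 4)) (min (κ / (4 * K ^ 2)) (1 / (4 * K)))), ?_,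
      min_le_left _ _, ?_, ?_, ?_⟩
    · refine lt_min one_pos (lt_min ?_ (lt_min ?_ ?_)) <;> positivity
    all_goals rw [mul_right_comm, ← le_div_iff₀' (by positivity)]
    · exact (min_le_right _ _).trans (min_le_left _ _)
    · exact (min_le_right _ _).trans ((min_le_right _ _).trans (min_le_left _ _))
    · exact (min_le_right _ _).trans ((min_le_right _ _).trans (min_le_right _ _))
  -- The threshold involves `k`, `κ`, `σ`, `c` and `K` only, so it is as uniform as the gradient
  -- bound `L`.
  set τs := max ((2 * K ^ 2 + 16 * K ^ 4 / κ) / k) (32 * K ^ 4 / (σ * k) / c) with hτs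
  have hs0 : 0 < τs := lt_max_of_lt_left (by positivity)
  have hs1 : 2 * K ^ 2 + 16 * K ^ 4 / κ ≤ k * τs := by
    rw [← div_le_iff₀' hk]; exact le_max_left _ _
  have hs2 : 32 * K ^ 4 / (σ * k) ≤ c * τs := by
    rw [← div_le_iff₀' hc0]; exact le_max_right _ _
  refine ⟨τs, hs0, fun τp τd hτp hτd => ?_⟩
  have hp0 : 0 < τp := hs0.trans hτp
  have hd0 : 0 < τd := hs0.trans hτd
  have hm0 : 0 < min τp τd := lt_min hp0 hd0
  choose V' hV' hV'v using loopLyapunov_hasFDerivAt hPs Q M τp τd (c * min τp τd)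
  refine ⟨loopLyapunov P Q M τp τd (c * min τp τd), V', _, _,
    min (k * τp / 2) (min (κ / 4) (c * min τp τd / τp * σ / 2)) / (2 + 2 * ‖Q‖ ^ 2),
    by positivity, ?_, hV', loopLyapunov_lower hPl Q M hKM hc0.le hc4 hp0 hd0,
    loopLyapunov_upper P Q M hp0.le hd0.le (by positivity), ?_⟩
  · refine div_pos (lt_min ?_ (lt_min ?_ ?_)) ?_ <;> positivity
  · intro e v g d h1 h2 h3 h4 h5 h6
    rw [hV'v, h1]
    refine (loopLyapunov_decrease hK1 hk hκ hσ hc0 hc1 hc2 hc3 hs1 hs2 hs0 hτp.le hτd.le hPA hKPQ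
      hKM hKS hMσ h2 h3 h4 (h5.trans (by gcongr)) (h6.trans (by gcongr))).trans ?_
    have h7 := norm_sq_le_deviation Q e
    set l := min (k * τp / 2) (min (κ / 4) (c * min τp τd / τp * σ / 2)) with hl
    have hl0 : 0 < l := by
      refine lt_min ?_ (lt_min ?_ ?_) <;> positivity
    rw [neg_mul, neg_mul, neg_le_neg_iff, div_mul_eq_mul_div, div_le_iff₀ (by positivity)]
    have := mul_le_mul_of_nonneg_left h7 hl0.le
    linarith

end Lyapunov

end OSS

namespace OSS
open Set Filter Topology Metric
open scoped NNReal RealInnerProductSpace Gradient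

/-! ### Strong convexity and uniform Lipschitz constants -/

section Convex

variable {F : Type*} [NormedAddCommGroup F] [InnerProductSpace ℝ F] [CompleteSpace F]

/-- The first-order lower bound of a strongly convex function. -/
lemma add_inner_add_sq_le_of_strongConvexOn {s : Set F} {κ : ℝ} {f : F → ℝ}
    (hf : StrongConvexOn s κ f) {x y f' : F} (hx : x ∈ s) (hy : y ∈ s)
    (hd : HasGradientAt f f' x) :
    f x + ⟪f', y - x⟫ + κ / 2 * ‖x - y‖ ^ 2 ≤ f y := by
  have hline : HasDerivAt (fun t : ℝ => x + t • (y - x)) (y - x) 0 := by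
    simpa using ((hasDerivAt_id (0 : ℝ)).smul_const (y - x)).const_add x
  have hd0 : HasFDerivAt f (InnerProductSpace.toDual ℝ F f') (x + (0 : ℝ) • (y - x)) := by
    simpa using hd.hasFDerivAt
  have hφ : HasDerivAt (fun t : ℝ => f (x + t • (y - x))) ⟪f', y - x⟫ 0 := by
    simpa [Function.comp_def] using hd0.comp_hasDerivAt 0 hline
  have hslope := (hasDerivAt_iff_tendsto_slope_zero.1 hφ).mono_left
    (nhdsWithin_mono 0 (fun t (ht : t ∈ Ioi (0 : ℝ)) => ne_of_gt ht))
  have hrhs : Tendsto (fun t : ℝ => f y - f x - (1 - t) * (κ / 2 * ‖x - y‖ ^ 2)) (𝓝[>] 0)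
      (𝓝 (f y - f x - (1 - 0) * (κ / 2 * ‖x - y‖ ^ 2))) := by
    refine Tendsto.mono_left (Continuous.tendsto ?_ 0) nhdsWithin_le_nhds
    fun_prop
  have h := le_of_tendsto_of_tendsto hslope hrhs ?_
  · linarith
  · filter_upwards [Ioo_mem_nhdsGT (zero_lt_one (α := ℝ))] with t ht
    have h1 := hf.2 hx hy (sub_nonneg.2 ht.2.le) ht.1.le (by ring)
    have e : (1 - t) • x + t • y = x + t • (y - x) := by module
    rw [e] at h1
    simp only [smul_eq_mul, zero_add, zero_smul, add_zero] at h1 ⊢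
    rw [inv_mul_le_iff₀ ht.1]
    linarith

/-- The gradient of a strongly convex function is strongly monotone. -/
lemma strongConvexOn_inner_gradient {s : Set F} {κ : ℝ} {f : F → ℝ}
    (hf : StrongConvexOn s κ f) {x y f'x f'y : F} (hx : x ∈ s) (hy : y ∈ s)
    (hdx : HasGradientAt f f'x x) (hdy : HasGradientAt f f'y y) :
    κ * ‖x - y‖ ^ 2 ≤ ⟪f'x - f'y, x - y⟫ := by
  have h1 := add_inner_add_sq_le_of_strongConvexOn hf hx hy hdx
  have h2 := add_inner_add_sq_le_of_strongConvexOn hf hy hx hdy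
  rw [norm_sub_rev y x] at h2
  rw [← neg_sub x y, inner_neg_right] at h1
  rw [inner_sub_left]
  linarith

/-- On a compact set of points a locally Lipschitz function has one Lipschitz constant which is
valid near each of the points. -/
lemma exists_uniform_lipschitz_of_isCompact {X Y Z : Type*} [TopologicalSpace Y]
    [PseudoMetricSpace X] [PseudoMetricSpace Z] {W : Set Y} (hW : IsCompact W) {γ : Y → X}
    (hγ : ContinuousOn γ W) {O : Set X} (hO : IsOpen O) (hγO : MapsTo γ W O) {f : X → Z}
    (hf : LocallyLipschitzOn O f) :
    ∃ L : ℝ≥0, ∀ w ∈ W, ∃ r > 0, LipschitzOnWith L f (ball (γ w) r) := by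
  -- The induction ranges over arbitrary sets, so membership in `W` is carried separately.
  have key : ∃ L : ℝ≥0, ∀ w ∈ W, w ∈ W → ∃ r > 0, LipschitzOnWith L f (ball (γ w) r) := by
    refine hW.induction_on (p := fun s => ∃ L : ℝ≥0, ∀ w ∈ s, w ∈ W →
      ∃ r > 0, LipschitzOnWith L f (ball (γ w) r)) ⟨0, by simp⟩ ?_ ?_ ?_
    · rintro s t hst ⟨L, hL⟩
      exact ⟨L, fun w hw => hL w (hst hw)⟩
    · rintro s t ⟨L, hL⟩ ⟨L', hL'⟩
      refine ⟨max L L', fun w hw hwW => ?_⟩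
      rcases hw with hw | hw
      · obtain ⟨r, hr, h⟩ := hL w hw hwW
        exact ⟨r, hr, h.weaken (le_max_left _ _)⟩
      · obtain ⟨r, hr, h⟩ := hL' w hw hwW
        exact ⟨r, hr, h.weaken (le_max_right _ _)⟩
    · intro w hw
      obtain ⟨L, t, ht, hLt⟩ := hf (hγO hw)
      rw [hO.nhdsWithin_eq (hγO hw)] at ht
      obtain ⟨r, hr, hrt⟩ := Metric.mem_nhds_iff.1 ht
      refine ⟨γ ⁻¹' ball (γ w) r, hγ w hw (ball_mem_nhds _ hr), L, fun v hv _ => ?_⟩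
      obtain ⟨δ, hδ, hδr⟩ := Metric.isOpen_iff.1 isOpen_ball _ hv
      exact ⟨δ, hδ, hLt.mono (hδr.trans hrt)⟩
  obtain ⟨L, hL⟩ := key
  exact ⟨L, fun w hw => hL w hw hw⟩

end Convex

/-! ### The reduced steady-state problem: multipliers and continuity of the optimum -/

namespace Problem

variable {n m r nw nc : ℕ}

/-- The matrix `H_z G_u + H_u` of the steady-state constraint. -/
noncomputable def cstr (P : Problem n m r nw nc) : Vec m →L[ℝ] Vec nc :=
  actL (P.Hz * P.Gu + P.Hu)

/-- The effect `H_z G_w + H_w` of the disturbance on the steady-state constraint. -/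
noncomputable def cstrDist (P : Problem n m r nw nc) : Vec nw →L[ℝ] Vec nc :=
  actL (P.Hz * P.Gw + P.Hw)

/-- The steady-state cost as a function of the input. -/
noncomputable def cost (P : Problem n m r nw nc) (w : Vec nw) (u : Vec m) : ℝ :=
  P.f₀ u + P.g₀ (P.steadyOutput w u)

/-- The gradient of the steady-state cost. -/
noncomputable def costGrad (P : Problem n m r nw nc) (w : Vec nw) (u : Vec m) : Vec m :=
  ∇ P.f₀ u + (actL P.Gu).adjoint (∇ P.g₀ (P.steadyOutput w u))

/-- The set of inputs at which the cost is defined. -/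
def inputs (P : Problem n m r nw nc) (w : Vec nw) : Set (Vec m) :=
  {u | u ∈ P.U ∧ P.steadyOutput w u ∈ P.Z}

lemma continuous_steadyOutput (P : Problem n m r nw nc) :
    Continuous fun q : Vec nw × Vec m => P.steadyOutput q.1 q.2 := by
  simp only [steadyOutput, act_eq_actL]
  fun_prop

/-- Eliminating the output leaves an affine equation in the input alone. -/
lemma violation_steadyOutput (P : Problem n m r nw nc) (w : Vec nw) (u : Vec m) :
    P.violation w u (P.steadyOutput w u) = P.cstr u + P.cstrDist w := by
  simp only [violation, steadyOutput, cstr, cstrDist, act_eq_actL, actL_add, actL_mul,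
    map_add, add_apply, ContinuousLinearMap.comp_apply]
  abel

lemma hasGradientAt_cost {P : Problem n m r nw nc} (hP : P.Standing) {w : Vec nw} {u : Vec m}
    (hu : u ∈ interior P.U) (hz : P.steadyOutput w u ∈ interior P.Z) :
    HasGradientAt (P.cost w) (P.costGrad w u) u := by
  have hf : HasFDerivAt P.f₀ _ u :=
    (((hP.contDiff_f₀.differentiableOn one_ne_zero).differentiableAt
      (isOpen_interior.mem_nhds hu)).hasGradientAt).hasFDerivAt
  have hg : HasFDerivAt P.g₀ _ (P.steadyOutput w u) :=
    (((hP.contDiff_g₀.differentiableOn one_ne_zero).differentiableAt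
      (isOpen_interior.mem_nhds hz)).hasGradientAt).hasFDerivAt
  have hs : HasFDerivAt (P.steadyOutput w) (actL P.Gu) u :=
    (actL P.Gu).hasFDerivAt.add_const (act P.Gw w)
  rw [hasGradientAt_iff_hasFDerivAt]
  refine (hf.add (hg.comp u hs)).congr_fderiv ?_
  ext v
  simp [costGrad, ContinuousLinearMap.adjoint_inner_left]

lemma inner_costGrad {P : Problem n m r nw nc} (hP : P.Standing) {κ : ℝ} {w : Vec nw}
    (hκ : StrongConvexOn (P.inputs w) κ (P.cost w)) {u v : Vec m}
    (hu : u ∈ interior P.U) (hz : P.steadyOutput w u ∈ interior P.Z)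
    (hv : v ∈ interior P.U) (hzv : P.steadyOutput w v ∈ interior P.Z) :
    κ * ‖u - v‖ ^ 2 ≤ ⟪P.costGrad w u - P.costGrad w v, u - v⟫ :=
  strongConvexOn_inner_gradient hκ ⟨interior_subset hu, interior_subset hz⟩
    ⟨interior_subset hv, interior_subset hzv⟩ (hasGradientAt_cost hP hu hz)
    (hasGradientAt_cost hP hv hzv)

/-- Near an interior input the outputs are interior as well. -/
lemma eventually_interior (P : Problem n m r nw nc) {w : Vec nw} {u : Vec m}
    (hu : u ∈ interior P.U) (hz : P.steadyOutput w u ∈ interior P.Z) :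
    ∀ᶠ q : Vec nw × Vec m in 𝓝 (w, u), q.2 ∈ interior P.U ∧
      P.steadyOutput q.1 q.2 ∈ interior P.Z :=
  (continuous_snd.continuousAt.eventually (isOpen_interior.mem_nhds hu)).and
    (P.continuous_steadyOutput.continuousAt.eventually (isOpen_interior.mem_nhds hz))

/-- Fermat's rule on the constraint set. -/
lemma inner_costGrad_eq_zero {P : Problem n m r nw nc} (hP : P.Standing) {w : Vec nw} {u : Vec m}
    {z : Vec r} (hu : u ∈ interior P.U) (hz : z ∈ interior P.Z) (hopt : P.IsOptimal w u z)
    {v : Vec m} (hv : P.cstr v = 0) : ⟪P.costGrad w u, v⟫ = 0 := by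
  obtain ⟨⟨-, -, rfl, hviol⟩, hmin⟩ := hopt
  have hline : HasDerivAt (fun t : ℝ => u + t • v) v 0 := by
    simpa using ((hasDerivAt_id (0 : ℝ)).smul_const v).const_add u
  have hd : HasFDerivAt (P.cost w) (InnerProductSpace.toDual ℝ _ (P.costGrad w u))
      (u + (0 : ℝ) • v) := by
    simpa using (hasGradientAt_cost hP hu hz).hasFDerivAt
  have hφ : HasDerivAt (fun t : ℝ => P.cost w (u + t • v)) ⟪P.costGrad w u, v⟫ 0 := by
    simpa [Function.comp_def] using hd.comp_hasDerivAt 0 hline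
  refine IsLocalMin.hasDerivAt_eq_zero ?_ hφ
  have ht : Tendsto (fun t : ℝ => (w, u + t • v)) (𝓝 0) (𝓝 (w, u)) := by
    have : Continuous (fun t : ℝ => (w, u + t • v)) := by fun_prop
    simpa using this.tendsto 0
  -- The optimum is interior, so small moves along `v` of either sign stay feasible and the
  -- derivative vanishes.
  filter_upwards [ht.eventually (P.eventually_interior hu hz)] with t ht
  have := hmin (u + t • v) (P.steadyOutput w (u + t • v)) ⟨interior_subset ht.1,
    interior_subset ht.2, rfl, by
      rw [violation_steadyOutput] at hviol ⊢
      rw [map_add, map_smul, hv, smul_zero, add_zero, hviol]⟩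
  simpa [cost] using this

/-- Lagrange multipliers. -/
lemma exists_multiplier {P : Problem n m r nw nc} (hP : P.Standing) {w : Vec nw} {u : Vec m}
    {z : Vec r} (hu : u ∈ interior P.U) (hz : z ∈ interior P.Z) (hopt : P.IsOptimal w u z) :
    ∃ μ : Vec nc, P.costGrad w u + P.cstr.adjoint μ = 0 := by
  have h1 : P.costGrad w u ∈ (P.cstr.ker)ᗮ := by
    rw [Submodule.mem_orthogonal']
    exact fun v hv => inner_costGrad_eq_zero hP hu hz hopt hv
  -- The orthogonal complement of the kernel is the closure of the range of the adjoint, and in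
  -- finite dimension that range is closed.
  rw [ContinuousLinearMap.orthogonal_ker,
    (Submodule.closed_of_finiteDimensional _).submodule_topologicalClosure_eq] at h1
  obtain ⟨μ, hμ⟩ := h1
  have hμ' : P.cstr.adjoint μ = P.costGrad w u := hμ
  exact ⟨-μ, by rw [map_neg, hμ', add_neg_cancel]⟩

lemma cstr_surjective {P : Problem n m r nw nc} (hrank : (P.Hz * P.Gu + P.Hu).rank = nc) :
    P.cstr.range = ⊤ := by
  apply Submodule.eq_top_of_finrank_eq
  rw [finrank_euclideanSpace_fin]
  refine Eq.trans ?_ hrank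
  rw [Matrix.rank_eq_finrank_range_toLin _ (EuclideanSpace.basisFun (Fin nc) ℝ).toBasis
    (EuclideanSpace.basisFun (Fin m) ℝ).toBasis]
  rfl

/-- A surjective map has injective adjoint, and an injective linear map on a finite-dimensional
space is bounded below. -/
lemma exists_cstr_adjoint_lower {P : Problem n m r nw nc}
    (hrank : (P.Hz * P.Gu + P.Hu).rank = nc) :
    ∃ σ > 0, ∀ μ, σ * ‖μ‖ ^ 2 ≤ ‖P.cstr.adjoint μ‖ ^ 2 := by
  have hker : P.cstr.adjoint.ker = ⊥ := by
    rw [← ContinuousLinearMap.orthogonal_range, cstr_surjective hrank, Submodule.top_orthogonal_eq_bot]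
  obtain ⟨K, hK, h⟩ := LinearMap.exists_antilipschitzWith
    (P.cstr.adjoint : Vec nc →ₗ[ℝ] Vec m) hker
  have hK' : (0 : ℝ) < K := by exact_mod_cast hK
  refine ⟨((K : ℝ) ^ 2)⁻¹, by positivity, fun μ => ?_⟩
  have h1 : ‖μ‖ ≤ K * ‖P.cstr.adjoint μ‖ := by
    simpa using h.le_mul_dist μ 0
  rw [inv_mul_le_iff₀ (by positivity), ← mul_pow]
  gcongr

/-- The optimal input depends continuously on the disturbance. -/
lemma continuousOn_optimal {P : Problem n m r nw nc} (hP : P.Standing) {κ : ℝ} (hκ0 : 0 < κ)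
    (hκ : ∀ w ∈ P.W, StrongConvexOn (P.inputs w) κ (P.cost w))
    (hrank : (P.Hz * P.Gu + P.Hu).rank = nc) {ub : Vec nw → Vec m}
    (hub : ∀ w ∈ P.W, ub w ∈ interior P.U ∧ P.steadyOutput w (ub w) ∈ interior P.Z ∧
      P.IsOptimal w (ub w) (P.steadyOutput w (ub w))) :
    ContinuousOn ub P.W := by
  intro w₀ hw₀
  obtain ⟨hu₀, hz₀, hopt₀⟩ := hub w₀ hw₀
  obtain ⟨R, hR⟩ := P.cstr.exists_rightInverse_of_surjective (cstr_surjective hrank)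
  have hR' : ∀ e, P.cstr (R e) = e := fun e => DFunLike.congr_fun hR e
  -- A continuous competitor: the optimum at `w₀`, corrected by a right inverse to satisfy the
  -- equality constraint for `w`.
  set v : Vec nw → Vec m := fun w => ub w₀ + R (P.cstrDist (w₀ - w)) with hv
  have hvc : Continuous v := by fun_prop
  have hv0 : v w₀ = ub w₀ := by simp [hv]
  have hc : ∀ w ∈ P.W, P.cstr (ub w) + P.cstrDist w = 0 := fun w hw => by
    rw [← violation_steadyOutput]; exact (hub w hw).2.2.1.2.2.2
  have hdiff : ∀ w ∈ P.W, P.cstr (v w - ub w) = 0 := by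
    intro w hw
    have h1 := hc w hw
    have h2 := hc w₀ hw₀
    rw [map_sub, map_add, hR', map_sub, eq_neg_of_add_eq_zero_left h1,
      eq_neg_of_add_eq_zero_left h2]
    abel
  have hpair : Tendsto (fun w => (w, v w)) (𝓝 w₀) (𝓝 (w₀, ub w₀)) := by
    have : Continuous fun w => (w, v w) := by fun_prop
    simpa [hv0] using this.tendsto w₀
  have hgrad : ContinuousAt (fun w => P.costGrad w (v w)) w₀ := by
    have h1 : ContinuousAt (∇ P.f₀) (v w₀) := by
      rw [hv0]
      exact hP.locLip_f₀.continuousOn.continuousAt (isOpen_interior.mem_nhds hu₀)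
    have h2 : ContinuousAt (∇ P.g₀) (P.steadyOutput w₀ (v w₀)) := by
      rw [hv0]
      exact hP.locLip_g₀.continuousOn.continuousAt (isOpen_interior.mem_nhds hz₀)
    have h3 : ContinuousAt (fun w => P.steadyOutput w (v w)) w₀ :=
      (P.continuous_steadyOutput.comp (continuous_id.prodMk hvc)).continuousAt
    have h4 : ContinuousAt (fun w => ∇ P.g₀ (P.steadyOutput w (v w))) w₀ :=
      ContinuousAt.comp (f := fun w => P.steadyOutput w (v w)) h2 h3
    exact (h1.comp hvc.continuousAt).add ((actL P.Gu).adjoint.continuous.continuousAt.comp h4)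
  -- The gradients at both optima are orthogonal to `v w - ub w`, a kernel vector; strong
  -- monotonicity then bounds it by the change of the gradient along `v`.
  have hbound : ∀ᶠ w in 𝓝[P.W] w₀, ‖ub w - v w‖
      ≤ κ⁻¹ * ‖P.costGrad w (v w) - P.costGrad w₀ (v w₀)‖ := by
    filter_upwards [mem_nhdsWithin_of_mem_nhds (hpair.eventually (P.eventually_interior hu₀ hz₀)),
      self_mem_nhdsWithin] with w hw hwW
    obtain ⟨hu, hz, hopt⟩ := hub w hwW
    have h1 := inner_costGrad hP (hκ w hwW) hw.1 hw.2 hu hz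
    have h2 := inner_costGrad_eq_zero hP hu hz hopt (hdiff w hwW)
    have h3 := inner_costGrad_eq_zero hP hu₀ hz₀ hopt₀ (hdiff w hwW)
    rw [inner_sub_left, h2, sub_zero] at h1
    have h4 : κ * ‖v w - ub w‖ ^ 2
        ≤ ‖P.costGrad w (v w) - P.costGrad w₀ (v w₀)‖ * ‖v w - ub w‖ := by
      refine le_trans ?_ (real_inner_le_norm _ _)
      rw [inner_sub_left, hv0, h3, sub_zero]
      exact h1
    rw [norm_sub_rev, ← div_eq_inv_mul, le_div_iff₀' hκ0]
    rcases (norm_nonneg (v w - ub w)).eq_or_lt with h | h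
    · rw [← h, mul_zero]; exact norm_nonneg _
    · refine le_of_mul_le_mul_right ?_ h
      rw [mul_assoc, ← sq]
      exact h4
  have hzero : Tendsto (fun w => ub w - v w) (𝓝[P.W] w₀) (𝓝 0) := by
    refine squeeze_zero_norm' hbound ?_
    have : Tendsto (fun w => κ⁻¹ * ‖P.costGrad w (v w) - P.costGrad w₀ (v w₀)‖) (𝓝 w₀)
        (𝓝 (κ⁻¹ * ‖P.costGrad w₀ (v w₀) - P.costGrad w₀ (v w₀)‖)) :=
      ((hgrad.tendsto.sub_const _).norm).const_mul _
    rw [sub_self, norm_zero, mul_zero] at this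
    exact this.mono_left nhdsWithin_le_nhds
  have h := hzero.add ((hvc.tendsto w₀).mono_left nhdsWithin_le_nhds)
  simpa [ContinuousWithinAt, hv0] using h

end Problem

end OSS

namespace OSS
open Set Filter Topology Metric
open scoped NNReal RealInnerProductSpace Gradient

/-! ### Coordinates relative to the quasi-steady state -/

namespace Problem

variable {n m r nw nc : ℕ}

/-- The sensitivity `A⁻¹ B` of the quasi-steady state to the input. -/
noncomputable def stateGain (P : Problem n m r nw nc) : Vec m →L[ℝ] Vec n :=
  actL (P.A⁻¹ * P.B)

/-- The steady state for a constant input. -/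
noncomputable def steadyState (P : Problem n m r nw nc) (w : Vec nw) (u : Vec m) : Vec n :=
  -(P.stateGain u + actL (P.A⁻¹ * P.Bw) w)

lemma act_inv_act {P : Problem n m r nw nc} (hA : IsHurwitz P.A) (x : Vec n) :
    actL P.A (actL P.A⁻¹ x) = x := by
  rw [← ContinuousLinearMap.comp_apply, ← actL_mul,
    Matrix.mul_nonsing_inv _ ((Matrix.isUnit_iff_isUnit_det _).1 hA.isUnit), actL_one]
  rfl

lemma inv_act_act {P : Problem n m r nw nc} (hA : IsHurwitz P.A) (x : Vec n) :
    actL P.A⁻¹ (actL P.A x) = x := by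
  rw [← ContinuousLinearMap.comp_apply, ← actL_mul,
    Matrix.nonsing_inv_mul _ ((Matrix.isUnit_iff_isUnit_det _).1 hA.isUnit), actL_one]
  rfl

/-- The state equation in terms of the distance from the quasi-steady state. -/
lemma stateField_eq {P : Problem n m r nw nc} (hA : IsHurwitz P.A) (w : Vec nw) (x : Vec n)
    (u : Vec m) : P.stateField w x u = actL P.A (x - P.steadyState w u) := by
  simp only [stateField, steadyState, stateGain, act_eq_actL, actL_mul,
    ContinuousLinearMap.comp_apply, map_sub, map_neg, map_add, act_inv_act hA]
  abel

/-- The plant output in terms of the distance from the quasi-steady state. -/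
lemma plantOutput_eq (P : Problem n m r nw nc) (w : Vec nw) (x : Vec n) (u : Vec m) :
    P.plantOutput w x u = P.steadyOutput w u + actL P.C (x - P.steadyState w u) := by
  simp only [plantOutput, steadyOutput, steadyState, stateGain, Gu, Gw, act_eq_actL, actL_mul,
    actL_add, actL_neg, ContinuousLinearMap.comp_apply, map_sub, map_neg, map_add,
    add_apply, neg_apply]
  abel

lemma violation_eq (P : Problem n m r nw nc) (w : Vec nw) (u : Vec m) (y : Vec n) :
    P.violation w u (P.steadyOutput w u + actL P.C y)
      = P.cstr u + P.cstrDist w + (actL P.Hz).comp (actL P.C) y := by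
  rw [← violation_steadyOutput]
  simp only [violation, act_eq_actL, map_add, ContinuousLinearMap.comp_apply]
  abel

/-- Identifies the fast variable with the sheared coordinate of `loopLyapunov`, for `Q = stateGain`.
-/
lemma sub_steadyState (P : Problem n m r nw nc) (w : Vec nw) (x : Vec n) (u ub : Vec m) :
    x - P.steadyState w u = (x - P.steadyState w ub) + P.stateGain (u - ub) := by
  simp only [steadyState, map_sub]
  abel

end Problem

/-! ### The closed loop: equilibria and Lipschitz bounds -/

section Loop

open Problem

variable {n m r nw nc : ℕ}

lemma primalDual_loopField (P : Problem n m r nw nc) (τp τd : ℝ) (w : Vec nw)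
    (s : Vec n × (Vec m × Vec nc)) :
    (primalDual P τp τd).loopField P w s
      = (P.stateField w s.1 s.2.1,
          τp⁻¹ • (-∇ P.f₀ s.2.1 - (actL P.Gu).adjoint (∇ P.g₀ (P.plantOutput w s.1 s.2.1))
            - P.cstr.adjoint s.2.2),
          τd⁻¹ • P.violation w s.2.1 (P.plantOutput w s.1 s.2.1)) := by
  simp only [Controller.loopField, Controller.loopOutput, primalDual, act_eq_actL, actL_transpose,
    cstr]

lemma mem_primalDual_loopDomain (P : Problem n m r nw nc) (τp τd : ℝ) (w : Vec nw)
    (s : Vec n × (Vec m × Vec nc)) :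
    s ∈ (primalDual P τp τd).loopDomain P w ↔
      s.2.1 ∈ interior P.U ∧ P.plantOutput w s.1 s.2.1 ∈ interior P.Z := Iff.rfl

/-- Equilibria of the primal-dual loop are the Karush-Kuhn-Tucker points. -/
lemma primalDual_isEquilibrium_iff {P : Problem n m r nw nc} (hA : IsHurwitz P.A) {τp τd : ℝ}
    (hτp : 0 < τp) (hτd : 0 < τd) (w : Vec nw) (s : Vec n × (Vec m × Vec nc)) :
    IsEquilibrium ((primalDual P τp τd).loopField P w) ((primalDual P τp τd).loopDomain P w) s ↔
      s.1 = P.steadyState w s.2.1 ∧ s.2.1 ∈ interior P.U ∧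
      P.steadyOutput w s.2.1 ∈ interior P.Z ∧
      P.costGrad w s.2.1 + P.cstr.adjoint s.2.2 = 0 ∧ P.cstr s.2.1 + P.cstrDist w = 0 := by
  obtain ⟨x, u, μ⟩ := s
  rw [IsEquilibrium, mem_primalDual_loopDomain, primalDual_loopField, plantOutput_eq,
    violation_eq, stateField_eq hA]
  simp only [Prod.mk_eq_zero, smul_eq_zero, inv_eq_zero, hτp.ne', hτd.ne', false_or]
  have key : actL P.A (x - P.steadyState w u) = 0 ↔ x = P.steadyState w u := by
    refine ⟨fun h => ?_, fun h => by rw [h, sub_self, map_zero]⟩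
    have := inv_act_act hA (x - P.steadyState w u)
    rw [h, map_zero] at this
    exact sub_eq_zero.1 this.symm
  have hneg : ∀ a b c : Vec m, -a - b - c = 0 ↔ a + b + c = 0 := fun a b c => by
    rw [← neg_eq_zero]
    have : -(-a - b - c) = a + b + c := by abel
    rw [this]
  rw [key, hneg]
  constructor
  · rintro ⟨⟨h1, h2⟩, h3, h4, h5⟩
    rw [sub_eq_zero.2 h3, map_zero, add_zero] at h2 h4 h5
    exact ⟨h3, h1, h2, h4, h5⟩
  · rintro ⟨h3, h1, h2, h4, h5⟩
    rw [sub_eq_zero.2 h3, map_zero, map_zero, add_zero, add_zero]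
    exact ⟨⟨h1, h2⟩, h3, h4, h5⟩

/-- There is at most one Karush-Kuhn-Tucker point. -/
lemma kkt_unique {P : Problem n m r nw nc} (hP : P.Standing) {κ : ℝ} (hκ0 : 0 < κ) {w : Vec nw}
    (hκ : StrongConvexOn (P.inputs w) κ (P.cost w))
    (hrank : (P.Hz * P.Gu + P.Hu).rank = nc) {u v : Vec m} {μ ν : Vec nc}
    (hu : u ∈ interior P.U) (hz : P.steadyOutput w u ∈ interior P.Z)
    (hv : v ∈ interior P.U) (hzv : P.steadyOutput w v ∈ interior P.Z)
    (hμ : P.costGrad w u + P.cstr.adjoint μ = 0) (hν : P.costGrad w v + P.cstr.adjoint ν = 0)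
    (hcu : P.cstr u + P.cstrDist w = 0) (hcv : P.cstr v + P.cstrDist w = 0) :
    u = v ∧ μ = ν := by
  -- By the stationarity equations the right side is `⟪ν - μ, M (u - v)⟫`, which is zero since both
  -- inputs satisfy the constraint.
  have h1 := inner_costGrad hP hκ hu hz hv hzv
  rw [eq_neg_of_add_eq_zero_left hμ, eq_neg_of_add_eq_zero_left hν,
    show -P.cstr.adjoint μ - -P.cstr.adjoint ν = P.cstr.adjoint (ν - μ) by rw [map_sub]; abel,
    ContinuousLinearMap.adjoint_inner_left, map_sub, eq_neg_of_add_eq_zero_left hcu,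
    eq_neg_of_add_eq_zero_left hcv, sub_self, inner_zero_right] at h1
  have huv : u = v := by
    have h2 : ‖u - v‖ ^ 2 ≤ 0 := nonpos_of_mul_nonpos_right h1 hκ0
    have h3 : ‖u - v‖ = 0 := pow_eq_zero_iff two_ne_zero |>.1 (le_antisymm h2 (sq_nonneg _))
    exact sub_eq_zero.1 (norm_eq_zero.1 h3)
  refine ⟨huv, ?_⟩
  obtain ⟨σ, hσ, h⟩ := exists_cstr_adjoint_lower hrank
  have h4 : P.cstr.adjoint (μ - ν) = 0 := by
    rw [map_sub, eq_neg_of_add_eq_zero_right hμ, eq_neg_of_add_eq_zero_right hν, huv, sub_self]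
  have h5 := h (μ - ν)
  rw [h4, norm_zero, zero_pow two_ne_zero] at h5
  have h6 : ‖μ - ν‖ ^ 2 ≤ 0 := nonpos_of_mul_nonpos_right h5 hσ
  have h7 : ‖μ - ν‖ = 0 := pow_eq_zero_iff two_ne_zero |>.1 (le_antisymm h6 (sq_nonneg _))
  exact sub_eq_zero.1 (norm_eq_zero.1 h7)

/-- The primal-dual vector field is Lipschitz wherever the gradients are. -/
lemma primalDual_lipschitzOn (P : Problem n m r nw nc) (τp τd : ℝ) (w : Vec nw)
    {T : Set (Vec n × (Vec m × Vec nc))} {Bf : Set (Vec m)} {Bg : Set (Vec r)} {Lf Lg : ℝ≥0}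
    (hf : LipschitzOnWith Lf (∇ P.f₀) Bf) (hg : LipschitzOnWith Lg (∇ P.g₀) Bg)
    (hTf : ∀ s ∈ T, s.2.1 ∈ Bf) (hTg : ∀ s ∈ T, P.plantOutput w s.1 s.2.1 ∈ Bg) :
    ∃ K, LipschitzOnWith K ((primalDual P τp τd).loopField P w) T := by
  let X := Vec n × (Vec m × Vec nc)
  let πx : X →L[ℝ] Vec n := ContinuousLinearMap.fst ℝ _ _
  let πu : X →L[ℝ] Vec m := (ContinuousLinearMap.fst ℝ _ _).comp (ContinuousLinearMap.snd ℝ _ _)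
  let πμ : X →L[ℝ] Vec nc := (ContinuousLinearMap.snd ℝ _ _).comp (ContinuousLinearMap.snd ℝ _ _)
  have affine : ∀ {k : ℕ} (ℓ : X →L[ℝ] Vec k) (c : Vec k),
      LipschitzWith ‖ℓ‖₊ (fun s => ℓ s + c) := by
    intro k ℓ c
    refine LipschitzWith.of_dist_le_mul fun s t => ?_
    rw [dist_add_right]
    exact ℓ.lipschitz.dist_le_mul s t
  have hz := affine ((actL P.C).comp πx + (actL P.D).comp πu) (act P.Dw w)
  have hx := affine ((actL P.A).comp πx + (actL P.B).comp πu) (act P.Bw w)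
  have hgz := hg.comp hz.lipschitzOnWith (s := T) (fun s hs => hTg s hs)
  have hfu := hf.comp πu.lipschitz.lipschitzOnWith (s := T) (fun s hs => hTf s hs)
  have hgz' := (actL P.Gu).adjoint.lipschitz.comp_lipschitzOnWith hgz
  have hμ := (P.cstr.adjoint.comp πμ).lipschitz.lipschitzOnWith (s := T)
  have hmid := (lipschitzWith_smul τp⁻¹).comp_lipschitzOnWith ((hfu.neg.sub hgz').sub hμ)
  have hv := affine ((τd⁻¹ • actL P.Hz).comp ((actL P.C).comp πx + (actL P.D).comp πu)
    + (τd⁻¹ • actL P.Hu).comp πu) (τd⁻¹ • (act P.Hw w + act P.Hz (act P.Dw w)))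
  obtain ⟨K, h⟩ : ∃ K, LipschitzOnWith K _ T :=
    ⟨_, (hx.lipschitzOnWith (s := T)).prodMk (hmid.prodMk (hv.lipschitzOnWith (s := T)))⟩
  refine ⟨K, ?_⟩
  convert h using 1
  funext s
  rw [primalDual_loopField]
  refine Prod.ext rfl (Prod.ext rfl ?_)
  have hπx : πx s = s.1 := rfl
  have hπu : πu s = s.2.1 := rfl
  simp only [hπx, hπu, violation, plantOutput, act_eq_actL, map_add, smul_add,
    ContinuousLinearMap.comp_apply, add_apply, smul_apply]
  abel

/-- Uniform bounds for the gradients near the optimal points. -/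
lemma exists_uniform_gradient_lipschitz {P : Problem n m r nw nc} (hP : P.Standing) {κ : ℝ}
    (hκ0 : 0 < κ) (hκ : ∀ w ∈ P.W, StrongConvexOn (P.inputs w) κ (P.cost w))
    (hrank : (P.Hz * P.Gu + P.Hu).rank = nc) {ub : Vec nw → Vec m}
    (hub : ∀ w ∈ P.W, ub w ∈ interior P.U ∧ P.steadyOutput w (ub w) ∈ interior P.Z ∧
      P.IsOptimal w (ub w) (P.steadyOutput w (ub w))) :
    ∃ Lf Lg : ℝ≥0, ∀ w ∈ P.W, ∃ ρ > 0, LipschitzOnWith Lf (∇ P.f₀) (ball (ub w) ρ) ∧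
      LipschitzOnWith Lg (∇ P.g₀) (ball (P.steadyOutput w (ub w)) ρ) := by
  have hc := continuousOn_optimal hP hκ0 hκ hrank hub
  have hc' : ContinuousOn (fun w => P.steadyOutput w (ub w)) P.W := by
    simp only [steadyOutput, act_eq_actL]
    fun_prop
  obtain ⟨Lf, hLf⟩ := exists_uniform_lipschitz_of_isCompact hP.compact_W hc isOpen_interior
    (fun w hw => (hub w hw).1) hP.locLip_f₀
  obtain ⟨Lg, hLg⟩ := exists_uniform_lipschitz_of_isCompact hP.compact_W hc' isOpen_interior
    (fun w hw => (hub w hw).2.1) hP.locLip_g₀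
  refine ⟨Lf, Lg, fun w hw => ?_⟩
  obtain ⟨ρ, hρ, h1⟩ := hLf w hw
  obtain ⟨ρ', hρ', h2⟩ := hLg w hw
  exact ⟨min ρ ρ', lt_min hρ hρ', h1.mono (ball_subset_ball (min_le_left _ _)),
    h2.mono (ball_subset_ball (min_le_right _ _))⟩

/-- The bounds on the gradient terms of the loop in deviations from equilibrium. -/
lemma gradient_deviation_bounds {P : Problem n m r nw nc} {w : Vec nw} {u ub : Vec m} {y : Vec n}
    {Bf : Set (Vec m)} {Bg : Set (Vec r)} {Lf Lg : ℝ≥0}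
    (hf : LipschitzOnWith Lf (∇ P.f₀) Bf) (hg : LipschitzOnWith Lg (∇ P.g₀) Bg)
    (hu : u ∈ Bf) (hub : ub ∈ Bf) (hz : P.steadyOutput w u ∈ Bg)
    (hzb : P.steadyOutput w ub ∈ Bg) (hzy : P.steadyOutput w u + actL P.C y ∈ Bg) :
    ‖P.costGrad w u - P.costGrad w ub‖ ≤ (Lf + ‖actL P.Gu‖ * Lg * ‖actL P.Gu‖) * ‖u - ub‖ ∧
    ‖(actL P.Gu).adjoint (∇ P.g₀ (P.steadyOutput w u + actL P.C y)
        - ∇ P.g₀ (P.steadyOutput w u))‖ ≤ (‖actL P.Gu‖ * Lg * ‖actL P.C‖) * ‖y‖ := by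
  have hadj : ∀ v, ‖(actL P.Gu).adjoint v‖ ≤ ‖actL P.Gu‖ * ‖v‖ := fun v =>
    (actL P.Gu).adjoint.le_of_opNorm_le (LinearIsometryEquiv.norm_map _ _).le v
  constructor
  · have e : P.costGrad w u - P.costGrad w ub = (∇ P.f₀ u - ∇ P.f₀ ub)
        + (actL P.Gu).adjoint (∇ P.g₀ (P.steadyOutput w u) - ∇ P.g₀ (P.steadyOutput w ub)) := by
      rw [costGrad, costGrad, map_sub]; abel
    have e2 : P.steadyOutput w u - P.steadyOutput w ub = actL P.Gu (u - ub) := by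
      simp only [steadyOutput, act_eq_actL, map_sub]; abel
    have h1 := hf.norm_sub_le hu hub
    have h2 := hg.norm_sub_le hz hzb
    rw [e2] at h2
    rw [e]
    calc _ ≤ _ := norm_add_le _ _
      _ ≤ Lf * ‖u - ub‖ + ‖actL P.Gu‖ * (Lg * (‖actL P.Gu‖ * ‖u - ub‖)) := by
        gcongr
        refine (hadj _).trans ?_
        gcongr
        refine h2.trans ?_
        gcongr
        exact (actL P.Gu).le_opNorm _
      _ = _ := by ring
  · have h2 := hg.norm_sub_le hzy hz
    rw [add_sub_cancel_left] at h2
    calc _ ≤ ‖actL P.Gu‖ * (Lg * (‖actL P.C‖ * ‖y‖)) := by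
          refine (hadj _).trans ?_
          gcongr
          refine h2.trans ?_
          gcongr
          exact (actL P.C).le_opNorm _
      _ = _ := by ring

end Loop

end OSS

/-! ### Stability uniform in the disturbance, and conclusion -/

open OSS OSS.Problem Set Filter Topology Metric in
open scoped NNReal RealInnerProductSpace Gradient in
/-- Local exponential stability of the Karush-Kuhn-Tucker point, for time constants that are large
uniformly in the disturbance. -/
theorem OSS.primalDual_isLocallyExpStable {n m r nw nc : ℕ} {P : OSS.Problem n m r nw nc}
    (hP : P.Standing) {κ : ℝ} (hκ0 : 0 < κ)
    (hκ : ∀ w ∈ P.W, StrongConvexOn (P.inputs w) κ (P.cost w))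
    (hrank : (P.Hz * P.Gu + P.Hu).rank = nc) {ub : Vec nw → Vec m}
    (hub : ∀ w ∈ P.W, ub w ∈ interior P.U ∧ P.steadyOutput w (ub w) ∈ interior P.Z ∧
      P.IsOptimal w (ub w) (P.steadyOutput w (ub w))) :
    ∃ τs > 0, ∀ τp τd : ℝ, τs < τp → τs < τd → ∀ w ∈ P.W, ∀ μ : Vec nc,
      P.costGrad w (ub w) + P.cstr.adjoint μ = 0 →
      IsLocallyExpStable ((primalDual P τp τd).loopField P w)
        ((primalDual P τp τd).loopDomain P w) (P.steadyState w (ub w), ub w, μ) := by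
  obtain ⟨Q, hQs, hQl, k, hk, hQA⟩ := hP.hurwitz.exists_lyapunov
  obtain ⟨σ, hσ, hMσ⟩ := exists_cstr_adjoint_lower hrank
  obtain ⟨Lf, Lg, hL⟩ := exists_uniform_gradient_lipschitz hP hκ0 hκ hrank hub
  obtain ⟨τs, hs0, hτ⟩ := exists_loop_lyapunov hQs hQl hk hQA P.stateGain P.cstr
    ((actL P.Hz).comp (actL P.C)) hσ hMσ hκ0
    (max (Lf + ‖actL P.Gu‖ * Lg * ‖actL P.Gu‖) (‖actL P.Gu‖ * Lg * ‖actL P.C‖))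
  refine ⟨τs, hs0, fun τp τd hτp hτd w hw μ hμ => ?_⟩
  obtain ⟨V, V', c, C, rate, hc, hrate, hVd, hVl, hVu, hdec⟩ := hτ τp τd hτp hτd
  obtain ⟨ρ, hρ, hLf, hLg⟩ := hL w hw
  obtain ⟨hu, hz, hopt⟩ := hub w hw
  have hp0 : 0 < τp := hs0.trans hτp
  have hd0 : 0 < τd := hs0.trans hτd
  have hcub : P.cstr (ub w) + P.cstrDist w = 0 := by
    rw [← violation_steadyOutput]; exact hopt.1.2.2.2
  set p : Vec n × (Vec m × Vec nc) := (P.steadyState w (ub w), ub w, μ) with hp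
  have heq : IsEquilibrium ((primalDual P τp τd).loopField P w)
      ((primalDual P τp τd).loopDomain P w) p :=
    (primalDual_isEquilibrium_iff hP.hurwitz hp0 hd0 w p).2 ⟨rfl, hu, hz, hμ, hcub⟩
  have hzp : P.plantOutput w p.1 p.2.1 = P.steadyOutput w (ub w) := by
    rw [plantOutput_eq, hp, sub_self, map_zero, add_zero]
  -- Both the steady and the actual output must lie in the Lipschitz region, since the perturbation
  -- compares the gradient at the two.
  have hev : ∀ᶠ s : Vec n × (Vec m × Vec nc) in 𝓝 p,
      (s.2.1 ∈ interior P.U ∧ s.2.1 ∈ ball (ub w) ρ) ∧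
      (P.steadyOutput w s.2.1 ∈ interior P.Z ∧
        P.steadyOutput w s.2.1 ∈ ball (P.steadyOutput w (ub w)) ρ) ∧
      (P.plantOutput w s.1 s.2.1 ∈ interior P.Z ∧
        P.plantOutput w s.1 s.2.1 ∈ ball (P.steadyOutput w (ub w)) ρ) := by
    have h1 : Continuous fun s : Vec n × (Vec m × Vec nc) => s.2.1 := by fun_prop
    have h2 : Continuous fun s : Vec n × (Vec m × Vec nc) => P.steadyOutput w s.2.1 := by
      simp only [steadyOutput, act_eq_actL]
      fun_prop
    have h3 : Continuous fun s : Vec n × (Vec m × Vec nc) => P.plantOutput w s.1 s.2.1 := by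
      simp only [plantOutput, act_eq_actL]
      fun_prop
    have near : ∀ {k : ℕ} (f : Vec n × (Vec m × Vec nc) → Vec k) (O : Set (Vec k)) (c : Vec k),
        Continuous f → IsOpen O → c ∈ O → f p = c → ∀ᶠ s in 𝓝 p, f s ∈ O ∧ f s ∈ ball c ρ := by
      intro k f O c hf hO hc hfp
      have h := hf.tendsto p
      rw [hfp] at h
      exact (h.eventually (hO.mem_nhds hc)).and (h.eventually (ball_mem_nhds c hρ))
    exact (near _ _ _ h1 isOpen_interior hu rfl).and ((near _ _ _ h2 isOpen_interior hz rfl).and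
      (near _ _ _ h3 isOpen_interior hz hzp))
  obtain ⟨R, hR, hball⟩ := Metric.eventually_nhds_iff_ball.1 hev
  -- The radius is halved because the Lyapunov theorem needs a Lipschitz bound on the ball of twice
  -- the radius.
  have hsub : ball p (R / 2) ⊆ ball p R := ball_subset_ball (by linarith)
  obtain ⟨K, hK⟩ := primalDual_lipschitzOn P τp τd w (T := ball p R) hLf hLg
    (fun s hs => (hball s hs).1.2) (fun s hs => (hball s hs).2.2.2)
  refine isLocallyExpStable_of_lyapunov heq (r := R / 2) (by positivity)
    (fun s hs => ⟨(hball s (hsub hs)).1.1, (hball s (hsub hs)).2.2.1⟩) (K := K)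
    (by rwa [mul_div_cancel₀ _ (two_ne_zero (α := ℝ))]) (V := fun s => V (s - p))
    (V' := fun s => V' (s - p)) (fun s => ?_) hc hrate (fun s => hVl (s - p))
    (fun s => hVu (s - p)) (fun s hs => ?_)
  · exact (hVd (s - p)).comp s ((hasFDerivAt_id s).sub_const p)
  obtain ⟨⟨hsU, hsf⟩, ⟨hsZ, hsg⟩, -, hsz⟩ := hball s (hsub hs)
  have hy : s.1 - P.steadyState w s.2.1 = (s - p).1 + P.stateGain (s - p).2.1 :=
    P.sub_steadyState w s.1 s.2.1 (ub w)
  set y := s.1 - P.steadyState w s.2.1 with hydef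
  rw [plantOutput_eq, ← hydef] at hsz
  obtain ⟨hb1, hb2⟩ := gradient_deviation_bounds hLf hLg hsf (mem_ball_self hρ) hsg
    (mem_ball_self hρ) hsz
  -- `g` is the change of the reduced gradient from the optimum, `d` the error from using the
  -- measured output in place of the steady one.
  refine hdec (s - p) _ (P.costGrad w s.2.1 - P.costGrad w (ub w))
    ((actL P.Gu).adjoint (∇ P.g₀ (P.steadyOutput w s.2.1 + actL P.C y)
        - ∇ P.g₀ (P.steadyOutput w s.2.1))) ?_ ?_ ?_ ?_ ?_ ?_
  · rw [primalDual_loopField, stateField_eq hP.hurwitz, ← hy]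
  · rw [primalDual_loopField, plantOutput_eq, ← hydef, smul_inv_smul₀ hp0.ne']
    have e : P.cstr.adjoint (s - p).2.2 = P.cstr.adjoint s.2.2 + P.costGrad w (ub w) := by
      rw [eq_neg_of_add_eq_zero_left hμ, ← sub_eq_add_neg, ← map_sub]
      rfl
    rw [e, costGrad, map_sub (actL P.Gu).adjoint]
    abel
  · rw [primalDual_loopField, plantOutput_eq, ← hydef, smul_inv_smul₀ hd0.ne', violation_eq, ← hy,
      eq_neg_of_add_eq_zero_right hcub, ← sub_eq_add_neg, ← map_sub]
    rfl
  · exact inner_costGrad hP (hκ w hw) hsU hsZ hu hz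
  · exact hb1.trans (mul_le_mul_of_nonneg_right (le_max_left _ _) (norm_nonneg _))
  · rw [← hy]
    exact hb2.trans (mul_le_mul_of_nonneg_right (le_max_right _ _) (norm_nonneg _))

theorem mainTheorem4 {n m r nw nc : ℕ} (P : OSS.Problem n m r nw nc) (hP : P.Standing)
    (hconv : ∃ κ : ℝ, 0 < κ ∧ ∀ w ∈ P.W,
      StrongConvexOn {u | u ∈ P.U ∧ P.steadyOutput w u ∈ P.Z} κ
        (fun u => P.f₀ u + P.g₀ (P.steadyOutput w u)))
    (hrank : (P.Hz * P.Gu + P.Hu).rank = nc) :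
    ∃ τs : ℝ, 0 < τs ∧ ∀ τp τd : ℝ, τs < τp → τs < τd →
      (OSS.primalDual P τp τd).SolvesOSS P := by
  obtain ⟨κ, hκ0, hκ⟩ := hconv
  have hex : ∀ w, ∃ u, w ∈ P.W → u ∈ interior P.U ∧ P.steadyOutput w u ∈ interior P.Z ∧
      P.IsOptimal w u (P.steadyOutput w u) := by
    intro w
    by_cases hw : w ∈ P.W
    · obtain ⟨u, hu, z, hz, hopt⟩ := hP.optimal w hw
      obtain rfl := hopt.1.2.2.1
      exact ⟨u, fun _ => ⟨hu, hz, hopt⟩⟩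
    -- An arbitrary value off `W`, so that the choice is a total function.
    · exact ⟨0, fun h => absurd h hw⟩
  choose ub hub using hex
  obtain ⟨τs, hs0, hτ⟩ := OSS.primalDual_isLocallyExpStable hP hκ0 hκ hrank hub
  refine ⟨τs, hs0, fun τp τd hτp hτd w hw => ?_⟩
  obtain ⟨hu, hz, hopt⟩ := hub w hw
  obtain ⟨μ, hμ⟩ := OSS.Problem.exists_multiplier hP hu hz hopt
  have hst := hτ τp τd hτp hτd w hw μ hμ
  have hp0 : 0 < τp := hs0.trans hτp
  have hd0 : 0 < τd := hs0.trans hτd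
  refine ⟨_, hst, fun q hq => ?_, ?_⟩
  · obtain ⟨h1, h2, h3, h4, h5⟩ :=
      (OSS.primalDual_isEquilibrium_iff hP.hurwitz hp0 hd0 w q).1 hq
    obtain ⟨-, -, -, -, hc⟩ :=
      (OSS.primalDual_isEquilibrium_iff hP.hurwitz hp0 hd0 w _).1 hst.1
    obtain ⟨e1, e2⟩ := OSS.kkt_unique hP hκ0 (hκ w hw) hrank h2 h3 hu hz h4 hμ h5 hc
    exact Prod.ext (by rw [h1, e1]) (Prod.ext e1 e2)
  · have e : (OSS.primalDual P τp τd).loopOutput P w (P.steadyState w (ub w), ub w, μ)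
        = P.steadyOutput w (ub w) := by
      change P.plantOutput w (P.steadyState w (ub w)) (ub w) = _
      rw [OSS.Problem.plantOutput_eq, sub_self, map_zero, add_zero]
    rw [e]
    exact hopt
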